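/- Let $\nu,\alpha,\beta,k,\omega$ be real numbers with $\alpha-|\nu|>-1$, $\beta>-1$, $k\ge 0$, $\omega>0$. Let $H^{(1)}_\nu=J_\nu+iY_\nu$ be the Hankel function of the first kind, and let $T_n^*(x)=T_n(2x-1)$ be the shifted Chebyshev polynomial of the first kind on $[0,1]$ (with $T^*_{-n}=T^*_n$). Put $$M(n)=M(n,k,\omega)=\int_0^1 x^\alpha(1-x)^\beta T_n^*(x)e^{2ikx}H^{(1)}_\nu(\omega x)\,dx,$$ and let $\widetilde M_n^{[1]},\widetilde M_n^{[2]},\widetilde M_n^{[3]}$ be the integrals obtained by inserting into the integrand the extra factor $\ln x$, $\ln(1-x)$, $\ln x\,\ln(1-x)$, respectively. Then all these integrals converge absolutely, and for every integer $n$ $$\widetilde M_n^{[1]}=\frac{\partial}{\partial\alpha}M(n,k,\omega),\qquad \widetilde M_n^{[2]}=\frac{\partial}{\partial\beta}M(n,k,\omega),\qquad \widetilde M_n^{[3]}=\frac{\partial^2}{\partial\alpha\,\partial\beta}M(n,k,\omega)$$ (the derivatives exist, the mixed one in either order). Moreover, for $\ell=1,2,3$ and all integers $n\ge 4$, $$\begin{aligned}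 &\Big(\tfrac{\omega^2}{16}-\tfrac{k^2}{4}\Big)\widetilde M^{[\ell]}_{n+4}+f_1(n)\widetilde M^{[\ell]}_{n+3}+f_2(n)\widetilde M^{[\ell]}_{n+2}+f_3(n)\widetilde M^{[\ell]}_{n+1}+f_4(n)\widetilde M^{[\ell]}_{n}\\ &\quad+f_3(-n)\widetilde M^{[\ell]}_{n-1}+f_2(-n)\widetilde M^{[\ell]}_{n-2}+f_1(-n)\widetilde M^{[\ell]}_{n-3}+\Big(\tfrac{\omega^2}{16}-\tfrac{k^2}{4}\Big)\widetilde M^{[\ell]}_{n-4}=r_n^{[\ell]}, \end{aligned}$$ where $$\begin{aligned} f_1(n)&=ik(\alpha+\beta+n+4)-\tfrac12 ik,\\ f_2(n)&=9+6(\alpha+\beta+n)+k^2+n^2+\alpha^2+\beta^2-\tfrac14\omega^2-\nu^2+2(\alpha\beta+\alpha n+\beta n)+ik(1-2\alpha+2\beta),\\ f_3(n)&=2n-8\alpha+12\beta+4(1-i\alpha k-i\beta k+\nu^2+\beta n-\alpha n)-\tfrac{31}{2}ik+3ik(\alpha+\beta-n+4)+4(\beta^2-\alpha^2),\\ f_4(n)&=6+4\alpha+12\beta-4\alpha\beta-2ik+4ik(\alpha-\beta)+\tfrac38\omega^2-\tfrac32k^2+6(\alpha^2+\beta^2-\nu^2)-2n^2,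 \end{aligned}$$ and $$\begin{aligned} r_n^{[1]}=-\big\{&ikM(n+3)+(6+2\beta+2n+2\alpha-2ik)M(n+2)-(8+ik+4n+8\alpha)M(n+1)\\ &+(4-4\beta+4ik+12\alpha)M(n)-(8+ik-4n+8\alpha)M(n-1)\\ &+(6+2\beta-2n+2\alpha-2ik)M(n-2)+ikM(n-3)\big\},\\ r_n^{[2]}=-\big\{&ikM(n+3)+(6+2\beta+2n+2\alpha+2ik)M(n+2)+(12-ik+4n+8\beta)M(n+1)\\ &+(12-4\alpha-4ik+12\beta)M(n)+(12-ik-4n+8\beta)M(n-1)\\ &+(6+2\beta-2n+2\alpha+2ik)M(n-2)+ikM(n-3)\big\},\\ r_n^{[3]}=-\big\{&ik\big(\widetilde M^{[1]}_{n+3}+\widetilde M^{[2]}_{n+3}\big)+(6+2\beta+2n+2\alpha+2ik)\widetilde M^{[1]}_{n+2}+(6+2\beta+2n+2\alpha-2ik)\widetilde M^{[2]}_{n+2}\\ &+2M(n+2)+(12-ik+4n+8\beta)\widetilde M^{[1]}_{n+1}-(8+ik+4n+8\alpha)\widetilde M^{[2]}_{n+1}\\ &+(12-4\alpha-4ik+12\beta)\widetilde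 M^{[1]}_{n}+(4-4\beta+4ik+12\alpha)\widetilde M^{[2]}_{n}-4M(n)\\ &+(12-ik-4n+8\beta)\widetilde M^{[1]}_{n-1}-(8+ik-4n+8\alpha)\widetilde M^{[2]}_{n-1}\\ &+(6+2\beta-2n+2\alpha+2ik)\widetilde M^{[1]}_{n-2}+(6+2\beta-2n+2\alpha-2ik)\widetilde M^{[2]}_{n-2}\\ &+2M(n-2)+ik\big(\widetilde M^{[1]}_{n-3}+\widetilde M^{[2]}_{n-3}\big)\big\}. \end{aligned}$$ -/

import Mathlib

open Filter Topology

noncomputable section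

/-- Bessel function of the first kind of real order `ν` at a positive real `x`, by its power series.
At the poles of `Γ` Mathlib has `Γ = 0`, so that the corresponding terms vanish, as they should. -/
def besselJ (ν x : ℝ) : ℝ :=
  ∑' m : ℕ, (-1) ^ m / ((m.factorial : ℝ) * Real.Gamma (m + ν + 1)) * (x / 2) ^ (2 * m + ν)

/-- The quotient that gives the Bessel function of the second kind for non-integral order. -/
def besselYQuot (ν x : ℝ) : ℝ :=
  (besselJ ν x * Real.cos (ν * Real.pi) - besselJ (-ν) x) / Real.sin (ν * Real.pi)

open Classical in
/-- Bessel function of the second kind of real order; for an integral order it is the limiting value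
of the quotient. -/
def besselY (ν x : ℝ) : ℝ :=
  if ∃ m : ℤ, ν = m then limUnder (𝓝[≠] ν) (fun μ : ℝ => besselYQuot μ x) else besselYQuot ν x

/-- Hankel function of the first kind. -/
def hankelH1 (ν x : ℝ) : ℂ := besselJ ν x + Complex.I * besselY ν x

/-- Shifted Chebyshev polynomial of the first kind, as a function on `[0, 1]`. -/
def shiftedChebyshevT (n : ℤ) (x : ℝ) : ℝ := (Polynomial.Chebyshev.T ℝ n).eval (2 * x - 1)

/-- The integrand of the modified moment of index `n`. -/
def momentIntegrand (ν k ω α β : ℝ) (n : ℤ) (x : ℝ) : ℂ :=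
  ((x ^ α * (1 - x) ^ β * shiftedChebyshevT n x : ℝ) : ℂ) *
    Complex.exp (Complex.I * (2 * k * x)) * hankelH1 ν (ω * x)

/-- The modified moment `M(n, k, ω)`. -/
def moment (ν k ω α β : ℝ) (n : ℤ) : ℂ :=
  ∫ x in (0 : ℝ)..1, momentIntegrand ν k ω α β n x

/-- The moment with the extra factor `ln x`. -/
def logMoment1 (ν k ω α β : ℝ) (n : ℤ) : ℂ :=
  ∫ x in (0 : ℝ)..1, (Real.log x : ℂ) * momentIntegrand ν k ω α β n x

/-- The moment with the extra factor `ln (1 - x)`. -/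
def logMoment2 (ν k ω α β : ℝ) (n : ℤ) : ℂ :=
  ∫ x in (0 : ℝ)..1, (Real.log (1 - x) : ℂ) * momentIntegrand ν k ω α β n x

/-- The moment with the extra factor `ln x * ln (1 - x)`. -/
def logMoment3 (ν k ω α β : ℝ) (n : ℤ) : ℂ :=
  ∫ x in (0 : ℝ)..1,
    (Real.log x : ℂ) * (Real.log (1 - x) : ℂ) * momentIntegrand ν k ω α β n x

/-- `f₁(n, α, β)` -/
def recCoeff1 (k α β : ℝ) (n : ℤ) : ℂ :=
  Complex.I * k * (α + β + n + 4) - 1 / 2 * Complex.I * k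

/-- `f₂(n, α, β)` -/
def recCoeff2 (ν k ω α β : ℝ) (n : ℤ) : ℂ :=
  9 + 6 * (α + β + n) + k ^ 2 + n ^ 2 + α ^ 2 + β ^ 2 - 1 / 4 * ω ^ 2 - ν ^ 2
    + 2 * (α * β + α * n + β * n) + Complex.I * k * (1 - 2 * α + 2 * β)

/-- `f₃(n, α, β)` -/
def recCoeff3 (ν k α β : ℝ) (n : ℤ) : ℂ :=
  2 * n - 8 * α + 12 * β
    + 4 * (1 - Complex.I * α * k - Complex.I * β * k + ν ^ 2 + β * n - α * n)
    - 31 / 2 * Complex.I * k + 3 * Complex.I * k * (α + β - n + 4) + 4 * (β ^ 2 - α ^ 2)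

/-- `f₄(n, α, β)` -/
def recCoeff4 (ν k ω α β : ℝ) (n : ℤ) : ℂ :=
  6 + 4 * α + 12 * β - 4 * α * β - 2 * Complex.I * k + 4 * Complex.I * k * (α - β)
    + 3 / 8 * ω ^ 2 - 3 / 2 * k ^ 2 + 6 * (α ^ 2 + β ^ 2 - ν ^ 2) - 2 * n ^ 2

/-- The left-hand side of the nine-term recurrence at index `n`, for a sequence `S`. -/
def nineTerm (ν k ω α β : ℝ) (S : ℤ → ℂ) (n : ℤ) : ℂ :=
  (1 / 16 * ω ^ 2 - 1 / 4 * k ^ 2) * S (n + 4)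
    + recCoeff1 k α β n * S (n + 3)
    + recCoeff2 ν k ω α β n * S (n + 2)
    + recCoeff3 ν k α β n * S (n + 1)
    + recCoeff4 ν k ω α β n * S n
    + recCoeff3 ν k α β (-n) * S (n - 1)
    + recCoeff2 ν k ω α β (-n) * S (n - 2)
    + recCoeff1 k α β (-n) * S (n - 3)
    + (1 / 16 * ω ^ 2 - 1 / 4 * k ^ 2) * S (n - 4)

/-- The right-hand side for the moments with factor `ln x`, built from the sequence `M` of moments. -/
def logRhs1 (k α β : ℝ) (M : ℤ → ℂ) (n : ℤ) : ℂ :=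
  -(Complex.I * k * M (n + 3)
    + (6 + 2 * β + 2 * n + 2 * α - 2 * Complex.I * k) * M (n + 2)
    - (8 + Complex.I * k + 4 * n + 8 * α) * M (n + 1)
    + (4 - 4 * β + 4 * Complex.I * k + 12 * α) * M n
    - (8 + Complex.I * k - 4 * n + 8 * α) * M (n - 1)
    + (6 + 2 * β - 2 * n + 2 * α - 2 * Complex.I * k) * M (n - 2)
    + Complex.I * k * M (n - 3))

/-- The right-hand side for the moments with factor `ln (1 - x)`. -/
def logRhs2 (k α β : ℝ) (M : ℤ → ℂ) (n : ℤ) : ℂ :=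
  -(Complex.I * k * M (n + 3)
    + (6 + 2 * β + 2 * n + 2 * α + 2 * Complex.I * k) * M (n + 2)
    + (12 - Complex.I * k + 4 * n + 8 * β) * M (n + 1)
    + (12 - 4 * α - 4 * Complex.I * k + 12 * β) * M n
    + (12 - Complex.I * k - 4 * n + 8 * β) * M (n - 1)
    + (6 + 2 * β - 2 * n + 2 * α + 2 * Complex.I * k) * M (n - 2)
    + Complex.I * k * M (n - 3))

/-- The right-hand side for the moments with factor `ln x * ln (1 - x)`, built from the moments `M`,
the moments `M₁` with factor `ln x` and the moments `M₂` with factor `ln (1 - x)`. -/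
def logRhs3 (k α β : ℝ) (M M₁ M₂ : ℤ → ℂ) (n : ℤ) : ℂ :=
  -(Complex.I * k * (M₁ (n + 3) + M₂ (n + 3))
    + (6 + 2 * β + 2 * n + 2 * α + 2 * Complex.I * k) * M₁ (n + 2)
    + (6 + 2 * β + 2 * n + 2 * α - 2 * Complex.I * k) * M₂ (n + 2)
    + 2 * M (n + 2)
    + (12 - Complex.I * k + 4 * n + 8 * β) * M₁ (n + 1)
    - (8 + Complex.I * k + 4 * n + 8 * α) * M₂ (n + 1)
    + (12 - 4 * α - 4 * Complex.I * k + 12 * β) * M₁ n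
    + (4 - 4 * β + 4 * Complex.I * k + 12 * α) * M₂ n
    - 4 * M n
    + (12 - Complex.I * k - 4 * n + 8 * β) * M₁ (n - 1)
    - (8 + Complex.I * k - 4 * n + 8 * α) * M₂ (n - 1)
    + (6 + 2 * β - 2 * n + 2 * α + 2 * Complex.I * k) * M₁ (n - 2)
    + (6 + 2 * β - 2 * n + 2 * α - 2 * Complex.I * k) * M₂ (n - 2)
    + 2 * M (n - 2)
    + Complex.I * k * (M₁ (n - 3) + M₂ (n - 3)))

end

/-!
With `θ = x d/dx`, the function `h x = H_ν(ω x)` satisfies Bessel's equation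
`θ² h = (ν² - (ω x)²) h`. Put `u = x ^ (α + 1) (1 - x) ^ (β + 2) exp (2 i k x) T_n(2 x - 1)`. By the
Lagrange identity the derivative of the concomitant `h θu - (θh) u` is
`h (θ² u - (ν² - (ω x)²) u) / x`, and the Chebyshev differential equation and three-term recurrence
turn this into the nine-term expression in the moment integrands. Near the origin `h` and `θh` are
`O(x ^ (-ρ))` for every `ρ > |ν|`, also at integral orders, where `Y_ν` is a combination of
derivatives of `J_μ` with respect to `μ`. Hence the concomitant vanishes at both endpoints and the
moments satisfy the homogeneous recurrence. Differentiating it in `α`, in `β`, and in both produces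
the factors `log x` and `log (1 - x)` under the integral sign, and the derivatives of the
coefficients make up the right-hand sides.
-/

noncomputable section

open MeasureTheory Set Asymptotics

/-! ### The reciprocal Gamma function on the real line -/

/-- The reciprocal of the Gamma function, an entire function restricted to the real line. Mathlib's
`Γ = 0` at the poles gives it the correct value `0` there. -/
def recipGamma (s : ℝ) : ℝ := (Real.Gamma s)⁻¹

theorem ofReal_recipGamma (s : ℝ) : (recipGamma s : ℂ) = (Complex.Gamma s)⁻¹ := by
  rw [recipGamma, Complex.ofReal_inv, Complex.Gamma_ofReal]

theorem recipGamma_eq_self_mul (s : ℝ) : recipGamma s = s * recipGamma (s + 1) := by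
  have h := Complex.one_div_Gamma_eq_self_mul_one_div_Gamma_add_one s
  rw [← ofReal_recipGamma, ← Complex.ofReal_one, ← Complex.ofReal_add, ← ofReal_recipGamma] at h
  exact_mod_cast h

theorem contDiff_recipGamma {n : WithTop ℕ∞} : ContDiff ℝ n recipGamma := by
  have h : ContDiff ℂ n fun s : ℂ => (Complex.Gamma s)⁻¹ :=
    Complex.differentiable_one_div_Gamma.contDiff
  refine contDiff_iff_contDiffAt.2 fun x => ?_
  convert! (h.contDiffAt (x := (x : ℂ))).real_of_complex using 1
  ext y
  rw [← ofReal_recipGamma, Complex.ofReal_re]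

theorem continuous_recipGamma : Continuous recipGamma :=
  contDiff_recipGamma.continuous (n := 0)

theorem hasDerivAt_recipGamma (s : ℝ) : HasDerivAt recipGamma (deriv recipGamma s) s :=
  (contDiff_recipGamma.differentiable one_ne_zero s).hasDerivAt

theorem continuous_deriv_recipGamma : Continuous (deriv recipGamma) :=
  contDiff_recipGamma.continuous_deriv le_rfl

theorem deriv_recipGamma_eq_self_mul_add (s : ℝ) :
    deriv recipGamma s = s * deriv recipGamma (s + 1) + recipGamma (s + 1) := by
  have hmul : HasDerivAt (fun s => s * recipGamma (s + 1))
      (1 * recipGamma (s + 1) + s * deriv recipGamma (s + 1)) s :=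
    (hasDerivAt_id s).mul ((hasDerivAt_recipGamma (s + 1)).comp_add_const s 1)
  rw [← funext recipGamma_eq_self_mul, one_mul, add_comm] at hmul
  exact hmul.deriv

/-- Boundedness on every half line `[a, ∞)`: the growth condition on `g` under which the series
`besselSeries g` converges locally uniformly in both variables. -/
def BddOnRays (g : ℝ → ℝ) : Prop := ∀ a, ∃ C, ∀ s, a ≤ s → |g s| ≤ C

theorem bddOnRays_of_abs_add_one_le {g : ℝ → ℝ} (hg : Continuous g) {b D : ℝ}
    (h : ∀ s, b ≤ s → |g (s + 1)| ≤ max |g s| D) : BddOnRays g := by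
  intro a
  set c := max a b
  obtain ⟨C, hC⟩ := (isCompact_Icc (a := a) (b := c + 1)).exists_bound_of_continuousOn
    hg.continuousOn
  have bound : ∀ N : ℕ, ∀ s, a ≤ s → s ≤ c + 1 + N → |g s| ≤ max C D := by
    intro N
    induction N with
    | zero => exact fun s has hs => (hC s ⟨has, by simpa using hs⟩).trans (le_max_left _ _)
    | succ N ih =>
      intro s has hs
      push_cast at hs
      rcases le_or_gt s (c + 1) with hsc | hsc
      · exact (hC s ⟨has, hsc⟩).trans (le_max_left _ _)
      · have hac : a ≤ c := le_max_left _ _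
        have hbc : b ≤ c := le_max_right _ _
        have hstep := h (s - 1) (by linarith)
        rw [sub_add_cancel] at hstep
        exact hstep.trans (max_le (ih (s - 1) (by linarith) (by linarith)) (le_max_right _ _))
  refine ⟨max C D, fun s has => ?_⟩
  obtain ⟨N, hN⟩ := exists_nat_ge (s - (c + 1))
  exact bound N s has (by linarith)

theorem bddOnRays_recipGamma : BddOnRays recipGamma := by
  refine bddOnRays_of_abs_add_one_le continuous_recipGamma (b := 1) (D := 0)
    fun s hs => le_max_of_le_left ?_
  calc |recipGamma (s + 1)| ≤ |s| * |recipGamma (s + 1)| :=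
        le_mul_of_one_le_left (abs_nonneg _) (hs.trans (le_abs_self s))
    _ = |recipGamma s| := by rw [recipGamma_eq_self_mul s, abs_mul]

theorem bddOnRays_deriv_recipGamma : BddOnRays (deriv recipGamma) := by
  obtain ⟨C, hC⟩ := bddOnRays_recipGamma 3
  refine bddOnRays_of_abs_add_one_le continuous_deriv_recipGamma (b := 2) (D := C)
    fun s hs => ?_
  have hdouble : 2 * |deriv recipGamma (s + 1)| ≤ |deriv recipGamma s| + C := by
    calc 2 * |deriv recipGamma (s + 1)| ≤ |s| * |deriv recipGamma (s + 1)| := by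
          gcongr
          exact hs.trans (le_abs_self s)
      _ = |deriv recipGamma s - recipGamma (s + 1)| := by
          rw [deriv_recipGamma_eq_self_mul_add s, add_sub_cancel_right, abs_mul]
      _ ≤ |deriv recipGamma s| + |recipGamma (s + 1)| := abs_sub _ _
      _ ≤ |deriv recipGamma s| + C := by gcongr; exact hC _ (by linarith)
  linarith [le_max_left |deriv recipGamma s| C, le_max_right |deriv recipGamma s| C]

/-! ### The power series behind the Bessel functions -/

/-- The series `∑ (-t)^m / m! g(m + μ + 1)`. For `g = 1 / Γ` this is the Bessel–Clifford function,
with `J_μ(x) = (x / 2)^μ besselSeries g μ (x² / 4)`; the choice `g = (1 / Γ)'` gives its derivative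
with respect to the order. -/
def besselSeries (g : ℝ → ℝ) (μ t : ℝ) : ℝ :=
  ∑' m : ℕ, (-t) ^ m / (m.factorial : ℝ) * g (m + μ + 1)

section BesselSeries

variable {g g' : ℝ → ℝ}

theorem summable_besselSeries (hg : BddOnRays g) (μ t : ℝ) :
    Summable fun m : ℕ => (-t) ^ m / (m.factorial : ℝ) * g (m + μ + 1) := by
  obtain ⟨C, hC⟩ := hg (μ + 1)
  refine .of_norm_bounded ((Real.summable_pow_div_factorial |t|).mul_right C) fun m => ?_
  simp only [norm_mul, norm_div, norm_pow, norm_neg, Real.norm_eq_abs, Nat.abs_cast]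
  gcongr
  exact hC _ (by linarith [m.cast_nonneg (α := ℝ)])

theorem hasSum_deriv_besselSeries (hg : BddOnRays g) (μ t : ℝ) :
    HasSum (fun m : ℕ => m * (-t) ^ (m - 1) / (m.factorial : ℝ) * g (m + μ + 1))
      (besselSeries g (μ + 1) t) := by
  rw [← hasSum_nat_add_iff' 1]
  simp only [Finset.range_one, Finset.sum_singleton, Nat.cast_zero, zero_mul, zero_div, sub_zero]
  convert! (summable_besselSeries hg (μ + 1) t).hasSum using 1
  ext m
  have hm : (m : ℝ) + 1 ≠ 0 := by positivity
  rw [Nat.factorial_succ, Nat.add_sub_cancel]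
  push_cast
  rw [show (m : ℝ) + 1 + μ + 1 = m + (μ + 1) + 1 by ring]
  field_simp

theorem hasDerivAt_besselSeries (hg : BddOnRays g) (μ t : ℝ) :
    HasDerivAt (besselSeries g μ) (-besselSeries g (μ + 1) t) t := by
  obtain ⟨C, hC⟩ := hg (μ + 1)
  set R := |t| + 1
  have hbound : Summable fun m : ℕ => m * R ^ (m - 1) / (m.factorial : ℝ) * C := by
    simpa only [neg_neg] using
      (hasSum_deriv_besselSeries (g := fun _ => C) (fun _ => ⟨|C|, fun _ _ => le_rfl⟩) 0
        (-R)).summable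
  have htR : t ∈ Metric.ball (0 : ℝ) R := by simp [R]
  rw [← (hasSum_deriv_besselSeries hg μ t).tsum_eq, ← tsum_neg]
  refine hasDerivAt_tsum_of_isPreconnected (t := Metric.ball 0 R)
    (g := fun (m : ℕ) t => (-t) ^ m / (m.factorial : ℝ) * g (m + μ + 1))
    (g' := fun (m : ℕ) t => -(m * (-t) ^ (m - 1) / (m.factorial : ℝ) * g (m + μ + 1)))
    hbound Metric.isOpen_ball (convex_ball _ _).isPreconnected (fun m y _ => ?_)
    (fun m y hy => ?_) htR (summable_besselSeries hg μ t) htR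
  · convert! ((((hasDerivAt_id y).neg.pow m).div_const (m.factorial : ℝ)).mul_const
      (g (m + μ + 1))) using 1
    simp only [Pi.neg_apply, id]
    ring
  · rw [mem_ball_zero_iff, Real.norm_eq_abs] at hy
    simp only [norm_neg, norm_mul, norm_div, norm_pow, Real.norm_eq_abs, Nat.abs_cast]
    gcongr
    exact hC _ (by linarith [m.cast_nonneg (α := ℝ)])

theorem hasDerivAt_besselSeries_order (hg : BddOnRays g) (hg' : BddOnRays g')
    (hd : ∀ s, HasDerivAt g (g' s) s) (μ t : ℝ) :
    HasDerivAt (fun μ => besselSeries g μ t) (besselSeries g' μ t) μ := by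
  obtain ⟨C, hC⟩ := hg' μ
  have hμ : μ ∈ Ioi (μ - 1) := by simp
  refine hasDerivAt_tsum_of_isPreconnected
    (g := fun (m : ℕ) μ => (-t) ^ m / (m.factorial : ℝ) * g (m + μ + 1))
    (g' := fun (m : ℕ) μ => (-t) ^ m / (m.factorial : ℝ) * g' (m + μ + 1))
    ((Real.summable_pow_div_factorial |t|).mul_right C) isOpen_Ioi isPreconnected_Ioi
    (fun m y _ => ?_) (fun m y hy => ?_) hμ (summable_besselSeries hg μ t) hμ
  · have hshift : HasDerivAt (fun y : ℝ => (m : ℝ) + y + 1) 1 y :=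
      ((hasDerivAt_id y).const_add (m : ℝ)).add_const 1
    simpa only [Function.comp_def, mul_one] using ((hd _).comp y hshift).const_mul _
  · simp only [norm_mul, norm_div, norm_pow, norm_neg, Real.norm_eq_abs, Nat.abs_cast]
    gcongr
    exact hC _ (by linarith [m.cast_nonneg (α := ℝ), mem_Ioi.1 hy])

theorem continuous_besselSeries (hg : BddOnRays g) (μ : ℝ) : Continuous (besselSeries g μ) :=
  continuous_iff_continuousAt.2 fun t => (hasDerivAt_besselSeries hg μ t).continuousAt

end BesselSeries

theorem besselSeries_recipGamma_sub_one (μ t : ℝ) :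
    besselSeries recipGamma (μ - 1) t
      = μ * besselSeries recipGamma μ t - t * besselSeries recipGamma (μ + 1) t := by
  have hmul := ((summable_besselSeries bddOnRays_recipGamma μ t).hasSum).mul_left μ
  have hderiv := (hasSum_deriv_besselSeries bddOnRays_recipGamma μ t).mul_left t
  refine HasSum.tsum_eq ?_
  convert! hmul.sub hderiv using 1
  ext m
  rw [show (m : ℝ) + (μ - 1) + 1 = m + μ by ring, recipGamma_eq_self_mul (m + μ)]
  rcases m with _ | m
  · simp
  · rw [Nat.add_sub_cancel, pow_succ]
    ring

/-! ### Bessel functions of the first kind -/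

theorem besselJ_eq {x : ℝ} (hx : 0 < x) (μ : ℝ) :
    besselJ μ x = (x / 2) ^ μ * besselSeries recipGamma μ ((x / 2) ^ 2) := by
  rw [besselJ, besselSeries, ← tsum_mul_left]
  congr 1
  ext m
  have hpow : (x / 2) ^ (2 * (m : ℝ) + μ) = (x / 2) ^ μ * ((x / 2) ^ 2) ^ m := by
    rw [add_comm, Real.rpow_add (by positivity), ← pow_mul, ← Real.rpow_natCast]
    push_cast
    rfl
  rw [hpow, recipGamma, neg_pow ((x / 2) ^ 2)]
  field_simp

/-- The derivative of `J_μ(x)` with respect to the order `μ`. At integral orders the Bessel function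
of the second kind is a combination of these. -/
def besselJOrderDeriv (μ x : ℝ) : ℝ :=
  (x / 2) ^ μ * (Real.log (x / 2) * besselSeries recipGamma μ ((x / 2) ^ 2)
    + besselSeries (deriv recipGamma) μ ((x / 2) ^ 2))

theorem hasDerivAt_besselJ_order {x : ℝ} (hx : 0 < x) (μ : ℝ) :
    HasDerivAt (fun μ => besselJ μ x) (besselJOrderDeriv μ x) μ := by
  have hpow : HasDerivAt (fun μ : ℝ => (x / 2) ^ μ) ((x / 2) ^ μ * Real.log (x / 2)) μ :=
    (Real.hasStrictDerivAt_const_rpow (by positivity) μ).hasDerivAt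
  have hseries := hasDerivAt_besselSeries_order bddOnRays_recipGamma bddOnRays_deriv_recipGamma
    hasDerivAt_recipGamma μ ((x / 2) ^ 2)
  rw [funext fun μ => besselJ_eq hx μ]
  convert! hpow.mul hseries using 1
  rw [besselJOrderDeriv]
  ring

theorem besselJ_sub_one {x : ℝ} (hx : 0 < x) (μ : ℝ) :
    besselJ (μ - 1) x = 2 * μ / x * besselJ μ x - besselJ (μ + 1) x := by
  rw [besselJ_eq hx, besselJ_eq hx, besselJ_eq hx, besselSeries_recipGamma_sub_one,
    Real.rpow_add_one (by positivity), Real.rpow_sub_one (by positivity)]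
  field_simp

theorem besselJOrderDeriv_sub_one {x : ℝ} (hx : 0 < x) (μ : ℝ) :
    besselJOrderDeriv (μ - 1) x
      = 2 / x * besselJ μ x + 2 * μ / x * besselJOrderDeriv μ x - besselJOrderDeriv (μ + 1) x := by
  have hleft : HasDerivAt (fun μ => besselJ (μ - 1) x) (besselJOrderDeriv (μ - 1) x) μ :=
    (hasDerivAt_besselJ_order hx (μ - 1)).comp_sub_const μ 1
  have hcoeff : HasDerivAt (fun μ : ℝ => 2 * μ / x) (2 / x) μ := by
    simpa using ((hasDerivAt_id μ).const_mul 2).div_const x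
  have hright := (hcoeff.mul (hasDerivAt_besselJ_order hx μ)).sub
    ((hasDerivAt_besselJ_order hx (μ + 1)).comp_add_const μ 1)
  rw [funext fun μ => besselJ_sub_one hx μ] at hleft
  exact hleft.unique hright

theorem besselJ_neg_natCast {x : ℝ} (hx : 0 < x) (n : ℕ) :
    besselJ (-n) x = (-1) ^ n * besselJ n x := by
  induction n using Nat.twoStepInduction with
  | zero => simp
  | one => simpa using besselJ_sub_one hx 0
  | more n ih ih' =>
    have hneg := besselJ_sub_one hx (-(n + 1 : ℕ))
    have hpos := besselJ_sub_one hx (n + 1 : ℕ)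
    push_cast at *
    rw [show -((n : ℝ) + 1) - 1 = -(n + 2) by ring, ih',
      show -((n : ℝ) + 1) + 1 = -n by ring, ih] at hneg
    rw [show (n : ℝ) + 1 - 1 = n by ring, show (n : ℝ) + 1 + 1 = n + 2 by ring] at hpos
    rw [hneg, hpos]
    ring

theorem besselJ_neg_intCast {x : ℝ} (hx : 0 < x) (n : ℤ) :
    besselJ (-n) x = (-1) ^ n * besselJ n x := by
  obtain ⟨m, rfl | rfl⟩ := n.eq_nat_or_neg
  · simpa using besselJ_neg_natCast hx m
  · rw [Int.cast_neg, neg_neg, Int.cast_natCast, besselJ_neg_natCast hx, ← mul_assoc, zpow_neg,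
      zpow_natCast, inv_mul_cancel₀ (pow_ne_zero m (by norm_num)), one_mul]

theorem hasDerivAt_half_rpow {x : ℝ} (hx : 0 < x) (μ : ℝ) :
    HasDerivAt (fun x : ℝ => (x / 2) ^ μ) (μ / x * (x / 2) ^ μ) x := by
  have hhalf : x / 2 ≠ 0 := by positivity
  convert! ((hasDerivAt_id x).div_const 2).rpow_const (p := μ) (Or.inl hhalf) using 1
  simp only [id]
  rw [Real.rpow_sub_one hhalf]
  field_simp

theorem hasDerivAt_besselSeries_half_sq {g : ℝ → ℝ} (hg : BddOnRays g) (μ x : ℝ) :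
    HasDerivAt (fun x => besselSeries g μ ((x / 2) ^ 2))
      (-(x / 2 * besselSeries g (μ + 1) ((x / 2) ^ 2))) x := by
  convert! (hasDerivAt_besselSeries hg μ ((x / 2) ^ 2)).comp x
    (((hasDerivAt_id x).div_const 2).pow 2) using 1
  simp only [id, Nat.cast_ofNat]
  ring

theorem hasDerivAt_besselJ {x : ℝ} (hx : 0 < x) (μ : ℝ) :
    HasDerivAt (besselJ μ) ((μ * besselJ μ x - x * besselJ (μ + 1) x) / x) x := by
  have hprod := (hasDerivAt_half_rpow hx μ).mul
    (hasDerivAt_besselSeries_half_sq bddOnRays_recipGamma μ x)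
  have heq : besselJ μ =ᶠ[𝓝 x]
      fun x => (x / 2) ^ μ * besselSeries recipGamma μ ((x / 2) ^ 2) := by
    filter_upwards [lt_mem_nhds hx] with y hy using besselJ_eq hy μ
  refine HasDerivAt.congr_of_eventuallyEq ?_ heq
  convert! hprod using 1
  rw [besselJ_eq hx, besselJ_eq hx, Real.rpow_add_one (by positivity)]
  field_simp
  ring

theorem hasDerivAt_besselJ_add_one {x : ℝ} (hx : 0 < x) (μ : ℝ) :
    HasDerivAt (besselJ (μ + 1)) ((x * besselJ μ x - (μ + 1) * besselJ (μ + 1) x) / x) x := by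
  have hladder := besselJ_sub_one hx (μ + 1)
  rw [add_sub_cancel_right] at hladder
  convert! hasDerivAt_besselJ hx (μ + 1) using 1
  rw [hladder]
  field_simp
  ring

theorem hasDerivAt_besselJOrderDeriv {x : ℝ} (hx : 0 < x) (μ : ℝ) :
    HasDerivAt (besselJOrderDeriv μ)
      ((besselJ μ x + μ * besselJOrderDeriv μ x - x * besselJOrderDeriv (μ + 1) x) / x) x := by
  have hlog : HasDerivAt (fun x : ℝ => Real.log (x / 2)) (1 / x) x := by
    convert! ((hasDerivAt_id x).div_const 2).log (by simpa using hx.ne') using 1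
    simp only [id]
    field_simp
  convert! (hasDerivAt_half_rpow hx μ).mul
    ((hlog.mul (hasDerivAt_besselSeries_half_sq bddOnRays_recipGamma μ x)).add
      (hasDerivAt_besselSeries_half_sq bddOnRays_deriv_recipGamma μ x)) using 1
  rw [besselJ_eq hx, besselJOrderDeriv, besselJOrderDeriv, Real.rpow_add_one (by positivity)]
  simp only [Pi.mul_apply, Pi.add_apply]
  field_simp
  ring

theorem hasDerivAt_besselJOrderDeriv_add_one {x : ℝ} (hx : 0 < x) (μ : ℝ) :
    HasDerivAt (besselJOrderDeriv (μ + 1))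
      ((x * besselJOrderDeriv μ x - besselJ (μ + 1) x
        - (μ + 1) * besselJOrderDeriv (μ + 1) x) / x) x := by
  have hladder := besselJOrderDeriv_sub_one hx (μ + 1)
  rw [add_sub_cancel_right] at hladder
  convert! hasDerivAt_besselJOrderDeriv hx (μ + 1) using 1
  rw [hladder]
  field_simp
  ring

/-! ### Growth at the origin -/

theorem rpow_isBigO_rpow_nhdsGT_zero {p q : ℝ} (h : q ≤ p) :
    (fun x : ℝ => x ^ p) =O[𝓝[>] 0] fun x => x ^ q := by
  refine .of_bound 1 ?_
  filter_upwards [Ioc_mem_nhdsGT (zero_lt_one' ℝ)] with x hx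
  rw [one_mul, Real.norm_of_nonneg (Real.rpow_nonneg hx.1.le _),
    Real.norm_of_nonneg (Real.rpow_nonneg hx.1.le _)]
  exact Real.rpow_le_rpow_of_exponent_ge hx.1 hx.2 h

section GrowthAtOrigin

variable {E : Type*} [NormedAddCommGroup E]

theorem isBigO_one_nhdsGT_of_continuous {f : ℝ → E} (hf : Continuous f) (a : ℝ) :
    f =O[𝓝[>] a] fun _ => (1 : ℝ) :=
  ((hf.tendsto a).isBigO_one ℝ).mono nhdsWithin_le_nhds

theorem isBigO_rpow_comp_const_mul {f : ℝ → E} {p c : ℝ} (hf : f =O[𝓝[>] 0] fun x => x ^ p)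
    (hc : 0 < c) : (fun x => f (c * x)) =O[𝓝[>] 0] fun x => x ^ p := by
  have hscale : Tendsto (c * ·) (𝓝[>] 0) (𝓝[>] 0) := by
    simpa only [comap_mulLeft_nhdsGT_zero hc] using
      tendsto_comap (f := (c * ·)) (x := 𝓝[>] (0 : ℝ))
  refine (hf.comp_tendsto hscale).trans ?_
  refine ((isBigO_refl (fun x : ℝ => x ^ p) _).const_mul_left (c ^ p)).congr' ?_ .rfl
  filter_upwards [self_mem_nhdsWithin] with x hx
  exact (Real.mul_rpow hc.le (mem_Ioi.1 hx).le).symm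

theorem smul_isBigO_nhdsGT_zero [NormedSpace ℝ E] {f : ℝ → E} {g : ℝ → ℝ}
    (hf : f =O[𝓝[>] 0] g) : (fun x => x • f x) =O[𝓝[>] 0] g := by
  simpa only [one_smul, smul_eq_mul, one_mul, id] using
    (isBigO_one_nhdsGT_of_continuous continuous_id (0 : ℝ)).smul hf

end GrowthAtOrigin

theorem rpow_mul_besselSeries_isBigO {g : ℝ → ℝ} (hg : BddOnRays g) {ρ μ : ℝ} (h : -ρ ≤ μ) :
    (fun t => t ^ μ * besselSeries g μ (t ^ 2)) =O[𝓝[>] 0] fun t => t ^ (-ρ) := by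
  have hseries : Continuous fun t : ℝ => besselSeries g μ (t ^ 2) :=
    (continuous_besselSeries hg μ).comp (continuous_pow 2)
  simpa only [mul_one] using
    (rpow_isBigO_rpow_nhdsGT_zero h).mul (isBigO_one_nhdsGT_of_continuous hseries 0)

theorem besselJ_isBigO {ρ μ : ℝ} (h : -ρ ≤ μ) : besselJ μ =O[𝓝[>] 0] fun x => x ^ (-ρ) := by
  refine (isBigO_rpow_comp_const_mul (rpow_mul_besselSeries_isBigO bddOnRays_recipGamma h)
    (inv_pos.2 two_pos)).congr' ?_ .rfl
  filter_upwards [self_mem_nhdsWithin] with x hx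
  rw [besselJ_eq hx, div_eq_inv_mul]

theorem besselJOrderDeriv_isBigO {ρ μ : ℝ} (h : -ρ < μ) :
    besselJOrderDeriv μ =O[𝓝[>] 0] fun x => x ^ (-ρ) := by
  have hlog := isBigO_rpow_zero_log_smul (neg_lt.1 h)
    (rpow_mul_besselSeries_isBigO bddOnRays_recipGamma (neg_neg μ).le)
  have hderiv := rpow_mul_besselSeries_isBigO bddOnRays_deriv_recipGamma h.le
  refine (isBigO_rpow_comp_const_mul (hlog.add hderiv) (inv_pos.2 two_pos)).congr_left fun x => ?_
  rw [besselJOrderDeriv, div_eq_inv_mul, smul_eq_mul]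
  ring

/-! ### Solutions of the Bessel equation -/

/-- `y` solves the inhomogeneous Bessel equation `θ² y = (ν² - ω² x²) y + s`, `θ = x d/dx`, on
`(0, ∞)`, and `y` and `w = θ y` are `O(x ^ (-ρ))` at the origin. The equation is encoded as a
first-order system for `(y, w)`. -/
structure IsBesselSolution {E : Type*} [NormedAddCommGroup E] [NormedSpace ℝ E] (ν ω ρ : ℝ)
    (s y w : ℝ → E) : Prop where
  hasDerivAt : ∀ x, 0 < x → HasDerivAt y (x⁻¹ • w x) x
  hasDerivAt_theta : ∀ x, 0 < x →
    HasDerivAt w (x⁻¹ • ((ν ^ 2 - (ω * x) ^ 2) • y x + s x)) x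
  isBigO : y =O[𝓝[>] 0] fun x => x ^ (-ρ)
  isBigO_theta : w =O[𝓝[>] 0] fun x => x ^ (-ρ)

namespace IsBesselSolution

variable {E F : Type*} [NormedAddCommGroup E] [NormedSpace ℝ E] [NormedAddCommGroup F]
  [NormedSpace ℝ F] {ν ω ρ : ℝ} {s s₁ y y₁ w w₁ : ℝ → E}

theorem add (h : IsBesselSolution ν ω ρ s y w) (h₁ : IsBesselSolution ν ω ρ s₁ y₁ w₁) :
    IsBesselSolution ν ω ρ (fun x => s x + s₁ x) (fun x => y x + y₁ x)
      (fun x => w x + w₁ x) where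
  hasDerivAt x hx := by
    rw [smul_add]
    exact (h.hasDerivAt x hx).add (h₁.hasDerivAt x hx)
  hasDerivAt_theta x hx := by
    convert! (h.hasDerivAt_theta x hx).add (h₁.hasDerivAt_theta x hx) using 1
    module
  isBigO := h.isBigO.add h₁.isBigO
  isBigO_theta := h.isBigO_theta.add h₁.isBigO_theta

theorem map (h : IsBesselSolution ν ω ρ s y w) (L : E →L[ℝ] F) :
    IsBesselSolution ν ω ρ (fun x => L (s x)) (fun x => L (y x)) (fun x => L (w x)) where
  hasDerivAt x hx := by
    rw [← map_smul]
    exact L.hasFDerivAt.comp_hasDerivAt x (h.hasDerivAt x hx)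
  hasDerivAt_theta x hx := by
    rw [← map_smul, ← map_add, ← map_smul]
    exact L.hasFDerivAt.comp_hasDerivAt x (h.hasDerivAt_theta x hx)
  isBigO := (L.isBigO_comp _ _).trans h.isBigO
  isBigO_theta := (L.isBigO_comp _ _).trans h.isBigO_theta

theorem congr (h : IsBesselSolution ν ω ρ s y w) (hs : ∀ x, 0 < x → s₁ x = s x)
    (hy : ∀ x, 0 < x → y₁ x = y x) : IsBesselSolution ν ω ρ s₁ y₁ w where
  hasDerivAt x hx := (h.hasDerivAt x hx).congr_of_eventuallyEq
    (by filter_upwards [lt_mem_nhds hx] with t ht using hy t ht)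
  hasDerivAt_theta x hx := by
    rw [hs x hx, hy x hx]
    exact h.hasDerivAt_theta x hx
  isBigO := h.isBigO.congr'
    (by filter_upwards [self_mem_nhdsWithin] with x hx using (hy x hx).symm) .rfl
  isBigO_theta := h.isBigO_theta

theorem of_neg_order (h : IsBesselSolution (-ν) ω ρ s y w) : IsBesselSolution ν ω ρ s y w := by
  obtain ⟨hy, hw, hyO, hwO⟩ := h
  simp only [neg_sq] at hw
  exact ⟨hy, hw, hyO, hwO⟩

theorem comp_const_mul (h : IsBesselSolution ν ω ρ s y w) {c : ℝ} (hc : 0 < c) :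
    IsBesselSolution ν (ω * c) ρ (fun x => s (c * x)) (fun x => y (c * x))
      (fun x => w (c * x)) where
  hasDerivAt x hx := by
    convert! (h.hasDerivAt _ (mul_pos hc hx)).scomp x ((hasDerivAt_id x).const_mul c) using 1
    rw [smul_smul]
    congr 1
    field_simp
  hasDerivAt_theta x hx := by
    convert! (h.hasDerivAt_theta _ (mul_pos hc hx)).scomp x ((hasDerivAt_id x).const_mul c) using 1
    rw [smul_smul, mul_assoc ω]
    congr 1
    field_simp
  isBigO := isBigO_rpow_comp_const_mul h.isBigO hc
  isBigO_theta := isBigO_rpow_comp_const_mul h.isBigO_theta hc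

end IsBesselSolution

theorem isBesselSolution_besselJ {ρ μ : ℝ} (hρ : -ρ < μ) :
    IsBesselSolution μ 1 ρ (fun _ => 0) (besselJ μ)
      (fun x => μ * besselJ μ x - x * besselJ (μ + 1) x) where
  hasDerivAt x hx := by
    simpa only [smul_eq_mul, div_eq_inv_mul] using hasDerivAt_besselJ hx μ
  hasDerivAt_theta x hx := by
    convert! ((hasDerivAt_besselJ hx μ).const_mul μ).sub
      ((hasDerivAt_id x).mul (hasDerivAt_besselJ_add_one hx μ)) using 1
    simp only [smul_eq_mul, id]
    field_simp
    ring
  isBigO := besselJ_isBigO hρ.le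
  isBigO_theta := ((besselJ_isBigO hρ.le).const_mul_left μ).sub
    (smul_isBigO_nhdsGT_zero (besselJ_isBigO (by linarith)))

theorem isBesselSolution_besselJOrderDeriv {ρ μ : ℝ} (hρ : -ρ < μ) :
    IsBesselSolution μ 1 ρ (fun x => 2 * μ * besselJ μ x) (besselJOrderDeriv μ)
      (fun x => besselJ μ x + μ * besselJOrderDeriv μ x - x * besselJOrderDeriv (μ + 1) x) where
  hasDerivAt x hx := by
    simpa only [smul_eq_mul, div_eq_inv_mul] using hasDerivAt_besselJOrderDeriv hx μ
  hasDerivAt_theta x hx := by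
    convert! ((hasDerivAt_besselJ hx μ).add
      ((hasDerivAt_besselJOrderDeriv hx μ).const_mul μ)).sub
      ((hasDerivAt_id x).mul (hasDerivAt_besselJOrderDeriv_add_one hx μ)) using 1
    simp only [smul_eq_mul, id]
    field_simp
    ring
  isBigO := besselJOrderDeriv_isBigO hρ
  isBigO_theta := ((besselJ_isBigO hρ.le).add
    ((besselJOrderDeriv_isBigO hρ).const_mul_left μ)).sub
      (smul_isBigO_nhdsGT_zero (besselJOrderDeriv_isBigO (by linarith)))

/-! ### Bessel functions of the second kind and Hankel functions -/

theorem tendsto_div_of_hasDerivAt_of_eq_zero {𝕜 : Type*} [NontriviallyNormedField 𝕜]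
    {f g : 𝕜 → 𝕜} {f' g' a : 𝕜} (hf : HasDerivAt f f' a) (hg : HasDerivAt g g' a)
    (hfa : f a = 0) (hga : g a = 0) (hg' : g' ≠ 0) :
    Tendsto (fun x => f x / g x) (𝓝[≠] a) (𝓝 (f' / g')) := by
  refine (hf.tendsto_slope.div hg.tendsto_slope hg').congr' ?_
  filter_upwards [self_mem_nhdsWithin] with x hx
  simp only [Pi.div_apply, slope_def_field, hfa, hga, sub_zero]
  exact div_div_div_cancel_right₀ (sub_ne_zero.2 hx) _ _

theorem besselY_intCast {x : ℝ} (hx : 0 < x) (n : ℤ) :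
    besselY n x
      = 1 / Real.pi * (besselJOrderDeriv n x + (-1) ^ n * besselJOrderDeriv (-n) x) := by
  have hcos : Real.cos (n * Real.pi) = (-1) ^ n := Real.cos_int_mul_pi n
  have hsin : Real.sin (n * Real.pi) = 0 := Real.sin_int_mul_pi n
  have hpow : ((-1 : ℝ) ^ n) * (-1) ^ n = 1 := by rw [← mul_zpow]; simp
  have hlin : HasDerivAt (fun μ : ℝ => μ * Real.pi) Real.pi (n : ℝ) := by
    simpa using (hasDerivAt_id (n : ℝ)).mul_const Real.pi
  have hnum : HasDerivAt (fun μ => besselJ μ x * Real.cos (μ * Real.pi) - besselJ (-μ) x)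
      (besselJOrderDeriv n x * (-1) ^ n + besselJOrderDeriv (-n) x) (n : ℝ) := by
    convert! ((hasDerivAt_besselJ_order hx n).mul hlin.cos).sub
      ((hasDerivAt_besselJ_order hx (-n)).comp (n : ℝ) (hasDerivAt_neg (n : ℝ))) using 1
    rw [hcos, hsin]
    ring
  have hden : HasDerivAt (fun μ => Real.sin (μ * Real.pi)) ((-1) ^ n * Real.pi) (n : ℝ) := by
    simpa [hcos] using hlin.sin
  have hlim := tendsto_div_of_hasDerivAt_of_eq_zero hnum hden
    (by rw [hcos, besselJ_neg_intCast hx]; ring) hsin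
    (mul_ne_zero (left_ne_zero_of_mul_eq_one hpow) Real.pi_ne_zero)
  rw [besselY, if_pos ⟨n, rfl⟩]
  refine Tendsto.limUnder_eq ?_
  convert! hlim using 2
  field_simp
  linear_combination (besselJOrderDeriv (-n) x) * hpow

theorem exists_isBesselSolution_besselY {ν ρ : ℝ} (hρ : |ν| < ρ) :
    ∃ w, IsBesselSolution ν 1 ρ (fun _ => 0) (besselY ν) w := by
  have hpos : -ρ < ν := by linarith [neg_abs_le ν]
  have hneg : -ρ < -ν := by linarith [le_abs_self ν]
  by_cases hν : ∃ m : ℤ, ν = m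
  · obtain ⟨n, rfl⟩ := hν
    have hpow : ((-1 : ℝ) ^ n) * (-1) ^ n = 1 := by rw [← mul_zpow]; simp
    refine ⟨_, (((isBesselSolution_besselJOrderDeriv hpos).add
      ((isBesselSolution_besselJOrderDeriv hneg).of_neg_order.map
        (ContinuousLinearMap.mul ℝ ℝ ((-1) ^ n)))).map
        (ContinuousLinearMap.mul ℝ ℝ (1 / Real.pi))).congr
        (fun x hx => ?_) fun x hx => besselY_intCast hx n⟩
    simp only [ContinuousLinearMap.mul_apply']
    rw [besselJ_neg_intCast hx]
    linear_combination (2 / Real.pi * n * besselJ n x) * hpow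
  · refine ⟨_, (((isBesselSolution_besselJ hpos).map
      (ContinuousLinearMap.mul ℝ ℝ (Real.cos (ν * Real.pi) / Real.sin (ν * Real.pi)))).add
      ((isBesselSolution_besselJ hneg).of_neg_order.map
        (ContinuousLinearMap.mul ℝ ℝ (-1 / Real.sin (ν * Real.pi))))).congr
        (fun x _ => by simp only [map_zero, add_zero]) fun x _ => ?_⟩
    rw [besselY, if_neg hν, besselYQuot]
    simp only [ContinuousLinearMap.mul_apply']
    ring

theorem exists_isBesselSolution_hankelH1 {ν ρ : ℝ} (hρ : |ν| < ρ) :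
    ∃ w, IsBesselSolution ν 1 ρ (fun _ => 0) (hankelH1 ν) w := by
  obtain ⟨w, hY⟩ := exists_isBesselSolution_besselY hρ
  refine ⟨_, (((isBesselSolution_besselJ (by linarith [neg_abs_le ν])).map Complex.ofRealCLM).add
    (hY.map (Complex.I • Complex.ofRealCLM))).congr (fun x _ => ?_) fun x _ => rfl⟩
  simp only [map_zero, add_zero]

/-! ### Differentiation under the integral sign in the exponents -/

section LogPowers

variable {X E : Type*} [MeasurableSpace X] {μ : Measure X} [NormedAddCommGroup E] [NormedSpace ℝ E]
  {p : X → ℝ} {F : X → E} {A a : ℝ}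

theorem abs_log_mul_rpow_le {t b ε : ℝ} (ht : t ∈ Ioc 0 1) (hε : 0 < ε) (h : a + ε ≤ b) :
    |Real.log t * t ^ b| ≤ 1 / ε * t ^ a := by
  have ha : 0 < t ^ a := Real.rpow_pos_of_pos ht.1 a
  calc |Real.log t * t ^ b| = |Real.log t| * t ^ b := by
        rw [abs_mul, abs_of_pos (Real.rpow_pos_of_pos ht.1 b)]
    _ ≤ |Real.log t| * t ^ (ε + a) := by
        gcongr |Real.log t| * ?_
        exact Real.rpow_le_rpow_of_exponent_ge ht.1 ht.2 (by linarith)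
    _ = |Real.log t * t ^ ε| * t ^ a := by
        rw [Real.rpow_add ht.1, abs_mul, abs_of_pos (Real.rpow_pos_of_pos ht.1 ε), mul_assoc]
    _ ≤ 1 / ε * t ^ a := by
        gcongr
        exact (Real.abs_log_mul_self_rpow_lt t ε ht.1 ht.2 hε).le

theorem hasDerivAt_integral_rpow_smul (hp : AEMeasurable p μ) (hp01 : ∀ᵐ x ∂μ, p x ∈ Ioc (0 : ℝ) 1)
    (hF : ∀ a, A < a → Integrable (fun x => p x ^ a • F x) μ) (ha : A < a) :
    Integrable (fun x => (Real.log (p x) * p x ^ a) • F x) μ ∧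
      HasDerivAt (fun a => ∫ x, p x ^ a • F x ∂μ) (∫ x, (Real.log (p x) * p x ^ a) • F x ∂μ) a := by
  obtain ⟨b, hAb, hba⟩ := exists_between ha
  obtain ⟨c, hbc, hca⟩ := exists_between hba
  refine hasDerivAt_integral_of_dominated_loc_of_deriv_le (s := Ioi c)
    (F := fun a x => p x ^ a • F x) (F' := fun a x => (Real.log (p x) * p x ^ a) • F x)
    (bound := fun x => 1 / (c - b) * ‖p x ^ b • F x‖) (Ioi_mem_nhds hca)
    ?_ (hF a ha) ?_ ?_ ((hF b hAb).norm.const_mul _) ?_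
  · filter_upwards [lt_mem_nhds ha] with a' ha' using (hF a' ha').aestronglyMeasurable
  · simp only [mul_smul]
    exact hp.log.aestronglyMeasurable.smul (hF a ha).aestronglyMeasurable
  · filter_upwards [hp01] with x hx a' ha'
    rw [norm_smul, norm_smul, ← mul_assoc, Real.norm_eq_abs, Real.norm_eq_abs,
      abs_of_pos (Real.rpow_pos_of_pos hx.1 b)]
    gcongr
    exact abs_log_mul_rpow_le hx (sub_pos.2 hbc) (by linarith [mem_Ioi.1 ha'])
  · filter_upwards [hp01] with x hx a' _
    simpa only [mul_comm (Real.log (p x))] using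
      (Real.hasStrictDerivAt_const_rpow hx.1 a').hasDerivAt.smul_const (F x)

theorem integrable_log_pow_mul_rpow_smul (hp : AEMeasurable p μ)
    (hp01 : ∀ᵐ x ∂μ, p x ∈ Ioc (0 : ℝ) 1)
    (hF : ∀ a, A < a → Integrable (fun x => p x ^ a • F x) μ) (i : ℕ) (ha : A < a) :
    Integrable (fun x => (Real.log (p x) ^ i * p x ^ a) • F x) μ := by
  induction i generalizing a with
  | zero => simpa only [pow_zero, one_mul] using hF a ha
  | succ i ih =>
    refine (hasDerivAt_integral_rpow_smul (F := fun x => Real.log (p x) ^ i • F x) hp hp01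
      (fun a ha => ?_) ha).1.congr (ae_of_all _ fun x => ?_)
    · simpa only [smul_smul, mul_comm] using ih ha
    · simp only [smul_smul]
      congr 1
      ring

theorem hasDerivAt_integral_log_pow_mul_rpow_smul (hp : AEMeasurable p μ)
    (hp01 : ∀ᵐ x ∂μ, p x ∈ Ioc (0 : ℝ) 1)
    (hF : ∀ a, A < a → Integrable (fun x => p x ^ a • F x) μ) (i : ℕ) (ha : A < a) :
    HasDerivAt (fun a => ∫ x, (Real.log (p x) ^ i * p x ^ a) • F x ∂μ)
      (∫ x, (Real.log (p x) ^ (i + 1) * p x ^ a) • F x ∂μ) a := by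
  have h := (hasDerivAt_integral_rpow_smul (F := fun x => Real.log (p x) ^ i • F x) hp hp01
    (fun a ha => by
      simpa only [smul_smul, mul_comm] using integrable_log_pow_mul_rpow_smul hp hp01 hF i ha) ha).2
  simpa only [smul_smul, pow_succ', mul_assoc, mul_comm (p _ ^ (_ : ℝ))] using h

end LogPowers

theorem exists_norm_le_of_continuousOn_Ioc {E : Type*} [NormedAddCommGroup E] {f : ℝ → E}
    {a b : ℝ} (hf : ContinuousOn f (Ioc a b)) (hO : f =O[𝓝[>] a] fun _ => (1 : ℝ)) :
    ∃ C, ∀ x ∈ Ioc a b, ‖f x‖ ≤ C := by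
  obtain ⟨C, hC⟩ := hO.bound
  obtain ⟨δ, hδ, hδC⟩ := (mem_nhdsGT_iff_exists_Ioo_subset (a := a)).1 hC
  obtain ⟨C', hC'⟩ := isCompact_Icc.exists_bound_of_continuousOn
    (hf.mono fun x (hx : x ∈ Icc δ b) => ⟨(mem_Ioi.1 hδ).trans_le hx.1, hx.2⟩)
  refine ⟨max C C', fun x hx => ?_⟩
  rcases lt_or_ge x δ with hxδ | hxδ
  · have hle := hδC ⟨hx.1, hxδ⟩
    rw [mem_ofPred_eq, norm_one, mul_one] at hle
    exact hle.trans (le_max_left _ _)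
  · exact (hC' x ⟨hxδ, hx.2⟩).trans (le_max_right _ _)

theorem integrableOn_rpow_mul_one_sub_rpow {a b : ℝ} (ha : -1 < a) (hb : -1 < b) :
    IntegrableOn (fun x : ℝ => x ^ a * (1 - x) ^ b) (Ioo 0 1) := by
  have hbeta := Complex.betaIntegral_convergent (u := ((a + 1 : ℝ) : ℂ)) (v := ((b + 1 : ℝ) : ℂ))
    (by rw [Complex.ofReal_re]; linarith) (by rw [Complex.ofReal_re]; linarith)
  rw [intervalIntegrable_iff_integrableOn_Ioo_of_le zero_le_one] at hbeta
  refine IntegrableOn.congr_fun hbeta.norm (fun x hx => ?_) measurableSet_Ioo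
  have hcast : (1 : ℂ) - x = ((1 - x : ℝ) : ℂ) := by push_cast; rfl
  rw [norm_mul, Complex.norm_cpow_eq_rpow_re_of_pos hx.1, hcast,
    Complex.norm_cpow_eq_rpow_re_of_pos (sub_pos.2 hx.2)]
  norm_num

theorem integrableOn_rpow_smul_one_sub_rpow_smul {E : Type*} [NormedAddCommGroup E]
    [NormedSpace ℝ E] {φ : ℝ → E} {ρ a b : ℝ} (hφ : ContinuousOn φ (Ioc 0 1))
    (hO : φ =O[𝓝[>] 0] fun x => x ^ (-ρ)) (ha : ρ - 1 < a) (hb : -1 < b) :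
    IntegrableOn (fun x => x ^ a • (1 - x) ^ b • φ x) (Ioo 0 1) := by
  have hcont : ContinuousOn (fun x => x ^ ρ • φ x) (Ioc 0 1) :=
    (continuousOn_id.rpow_const fun x hx => Or.inl hx.1.ne').smul hφ
  have hbdd : (fun x => x ^ ρ • φ x) =O[𝓝[>] 0] fun _ => (1 : ℝ) := by
    refine ((isBigO_refl (fun x : ℝ => x ^ ρ) _).smul hO).congr' EventuallyEq.rfl ?_
    filter_upwards [self_mem_nhdsWithin] with x hx
    rw [smul_eq_mul, ← Real.rpow_add hx, add_neg_cancel, Real.rpow_zero]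
  obtain ⟨C, hC⟩ := exists_norm_le_of_continuousOn_Ioc hcont hbdd
  have hint : IntegrableOn (fun x => (x ^ (a - ρ) * (1 - x) ^ b) • x ^ ρ • φ x) (Ioo 0 1) :=
    (integrableOn_rpow_mul_one_sub_rpow (by linarith) hb).smul_bdd C
      ((hcont.mono Ioo_subset_Ioc_self).aestronglyMeasurable measurableSet_Ioo)
      ((ae_restrict_mem measurableSet_Ioo).mono fun x hx => hC x (Ioo_subset_Ioc_self hx))
  refine hint.congr_fun (fun x hx => ?_) measurableSet_Ioo
  simp only [smul_smul]
  rw [mul_right_comm, ← Real.rpow_add hx.1, sub_add_cancel]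

section LogPowersTwo

variable {X E : Type*} [MeasurableSpace X] {μ : Measure X} [NormedAddCommGroup E] [NormedSpace ℝ E]
  {p q : X → ℝ} {F : X → E} {A B a b : ℝ}

theorem integrable_log_pow_mul_rpow_smul_smul (hp : AEMeasurable p μ)
    (hp01 : ∀ᵐ x ∂μ, p x ∈ Ioc (0 : ℝ) 1) (hq : AEMeasurable q μ)
    (hq01 : ∀ᵐ x ∂μ, q x ∈ Ioc (0 : ℝ) 1)
    (hF : ∀ a b, A < a → B < b → Integrable (fun x => p x ^ a • q x ^ b • F x) μ) (i j : ℕ)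
    (ha : A < a) (hb : B < b) :
    Integrable
      (fun x => (Real.log (p x) ^ i * p x ^ a) • (Real.log (q x) ^ j * q x ^ b) • F x) μ := by
  refine integrable_log_pow_mul_rpow_smul hp hp01 (fun a ha => ?_) i ha
  simp only [smul_comm (p _ ^ (_ : ℝ))]
  refine integrable_log_pow_mul_rpow_smul hq hq01 (fun b hb => ?_) j hb
  simpa only [smul_comm (p _ ^ (_ : ℝ))] using hF a b ha hb

theorem hasDerivAt_integral_log_pow_mul_rpow_smul_smul (hp : AEMeasurable p μ)
    (hp01 : ∀ᵐ x ∂μ, p x ∈ Ioc (0 : ℝ) 1) (hq : AEMeasurable q μ)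
    (hq01 : ∀ᵐ x ∂μ, q x ∈ Ioc (0 : ℝ) 1)
    (hF : ∀ a b, A < a → B < b → Integrable (fun x => p x ^ a • q x ^ b • F x) μ) (i j : ℕ)
    (ha : A < a) (hb : B < b) :
    HasDerivAt
      (fun a => ∫ x, (Real.log (p x) ^ i * p x ^ a) • (Real.log (q x) ^ j * q x ^ b) • F x ∂μ)
      (∫ x, (Real.log (p x) ^ (i + 1) * p x ^ a) • (Real.log (q x) ^ j * q x ^ b) • F x ∂μ) a :=
  hasDerivAt_integral_log_pow_mul_rpow_smul hp hp01
    (fun a ha => by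
      simpa only [pow_zero, one_mul] using
        integrable_log_pow_mul_rpow_smul_smul hp hp01 hq hq01 hF 0 j ha hb) i ha

end LogPowersTwo

/-! ### Moments with logarithmic factors -/

/-- The factor of the moment integrand that does not depend on the exponents. -/
def momentFactor (ν k ω : ℝ) (n : ℤ) (x : ℝ) : ℂ :=
  (shiftedChebyshevT n x : ℂ) * Complex.exp (Complex.I * (2 * k * x)) * hankelH1 ν (ω * x)

/-- The moment integrand with extra factors `(log x) ^ i` and `(log (1 - x)) ^ j`; the two integer
parameters let one lemma cover all the derivatives with respect to `α` and `β`. -/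
def logPowIntegrand (ν k ω : ℝ) (i j : ℕ) (α β : ℝ) (n : ℤ) (x : ℝ) : ℂ :=
  (Real.log x ^ i * x ^ α) • (Real.log (1 - x) ^ j * (1 - x) ^ β) • momentFactor ν k ω n x

/-- The modified moment with extra factors `(log x) ^ i` and `(log (1 - x)) ^ j`. -/
def logPowMoment (ν k ω : ℝ) (i j : ℕ) (α β : ℝ) (n : ℤ) : ℂ :=
  ∫ x in (0 : ℝ)..1, logPowIntegrand ν k ω i j α β n x

theorem logPowIntegrand_eq_mul_momentIntegrand (ν k ω : ℝ) (i j : ℕ) (α β : ℝ) (n : ℤ) (x : ℝ) :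
    logPowIntegrand ν k ω i j α β n x =
      (Real.log x : ℂ) ^ i * (Real.log (1 - x) : ℂ) ^ j * momentIntegrand ν k ω α β n x := by
  simp only [logPowIntegrand, momentFactor, momentIntegrand, Complex.real_smul]
  push_cast
  ring

theorem logPowMoment_zero_zero (ν k ω : ℝ) : logPowMoment ν k ω 0 0 = moment ν k ω := by
  ext α β n
  simp only [logPowMoment, moment, logPowIntegrand_eq_mul_momentIntegrand, pow_zero, one_mul]

theorem logPowMoment_one_zero (ν k ω : ℝ) : logPowMoment ν k ω 1 0 = logMoment1 ν k ω := by
  ext α β n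
  simp only [logPowMoment, logMoment1, logPowIntegrand_eq_mul_momentIntegrand, pow_zero, pow_one,
    mul_one]

theorem logPowMoment_zero_one (ν k ω : ℝ) : logPowMoment ν k ω 0 1 = logMoment2 ν k ω := by
  ext α β n
  simp only [logPowMoment, logMoment2, logPowIntegrand_eq_mul_momentIntegrand, pow_zero, pow_one,
    one_mul]

theorem logPowMoment_one_one (ν k ω : ℝ) : logPowMoment ν k ω 1 1 = logMoment3 ν k ω := by
  ext α β n
  simp only [logPowMoment, logMoment3, logPowIntegrand_eq_mul_momentIntegrand, pow_one]

theorem continuous_shiftedChebyshevT (n : ℤ) : Continuous (shiftedChebyshevT n) := by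
  unfold shiftedChebyshevT
  fun_prop

theorem momentFactor_isBigO {ν ρ ω : ℝ} (k : ℝ) (hω : 0 < ω) (n : ℤ) (hρ : |ν| < ρ) :
    momentFactor ν k ω n =O[𝓝[>] 0] fun x => x ^ (-ρ) := by
  obtain ⟨w, hw⟩ := exists_isBesselSolution_hankelH1 hρ
  have hcont : Continuous fun x : ℝ =>
      (shiftedChebyshevT n x : ℂ) * Complex.exp (Complex.I * (2 * k * x)) := by
    have := continuous_shiftedChebyshevT n
    fun_prop
  simpa only [one_mul] using!
    (isBigO_one_nhdsGT_of_continuous hcont 0).mul (isBigO_rpow_comp_const_mul hw.isBigO hω)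

theorem continuousOn_momentFactor (ν k : ℝ) {ω : ℝ} (hω : 0 < ω) (n : ℤ) :
    ContinuousOn (momentFactor ν k ω n) (Ioi 0) := by
  obtain ⟨w, hw⟩ := exists_isBesselSolution_hankelH1 (lt_add_one |ν|)
  have hHankel : ContinuousOn (hankelH1 ν) (Ioi 0) := fun x hx =>
    (hw.hasDerivAt x hx).continuousAt.continuousWithinAt
  refine ContinuousOn.mul (Continuous.continuousOn ?_)
    (hHankel.comp (by fun_prop) fun x hx => mul_pos hω hx)
  have := continuous_shiftedChebyshevT n
  fun_prop

section Moments

variable {ν ω α β : ℝ} (k : ℝ) (n : ℤ)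

theorem integrableOn_rpow_smul_momentFactor (hα : |ν| - 1 < α) (hβ : -1 < β) (hω : 0 < ω) :
    IntegrableOn (fun x => x ^ α • (1 - x) ^ β • momentFactor ν k ω n x) (Ioo 0 1) := by
  obtain ⟨ρ, hνρ, hρα⟩ := exists_between (sub_lt_iff_lt_add.1 hα)
  exact integrableOn_rpow_smul_one_sub_rpow_smul
    ((continuousOn_momentFactor ν k hω n).mono Ioc_subset_Ioi_self)
    (momentFactor_isBigO k hω n hνρ) (by linarith) hβ

theorem ae_mem_Ioc_and_one_sub_mem_Ioc :
    (∀ᵐ x ∂volume.restrict (Ioo (0 : ℝ) 1), x ∈ Ioc (0 : ℝ) 1) ∧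
      ∀ᵐ x ∂volume.restrict (Ioo (0 : ℝ) 1), 1 - x ∈ Ioc (0 : ℝ) 1 := by
  constructor <;> filter_upwards [ae_restrict_mem measurableSet_Ioo] with x hx
  · exact Ioo_subset_Ioc_self hx
  · exact ⟨by linarith [hx.2], by linarith [hx.1]⟩

theorem intervalIntegrable_log_pow_mul_momentIntegrand (i j : ℕ) (hα : |ν| - 1 < α) (hβ : -1 < β)
    (hω : 0 < ω) :
    IntervalIntegrable (fun x => (Real.log x : ℂ) ^ i * (Real.log (1 - x) : ℂ) ^ j *
      momentIntegrand ν k ω α β n x) volume 0 1 := by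
  simp only [← logPowIntegrand_eq_mul_momentIntegrand]
  rw [intervalIntegrable_iff_integrableOn_Ioo_of_le zero_le_one]
  exact integrable_log_pow_mul_rpow_smul_smul aemeasurable_id ae_mem_Ioc_and_one_sub_mem_Ioc.1
    (by fun_prop) ae_mem_Ioc_and_one_sub_mem_Ioc.2
    (fun a b ha hb => integrableOn_rpow_smul_momentFactor k n ha hb hω) i j hα hβ

theorem logPowMoment_eq_integral_Ioo (i j : ℕ) :
    logPowMoment ν k ω i j α β n = ∫ x in Ioo (0 : ℝ) 1, logPowIntegrand ν k ω i j α β n x := by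
  rw [logPowMoment, intervalIntegral.integral_of_le zero_le_one, integral_Ioc_eq_integral_Ioo]

theorem hasDerivAt_logPowMoment_left (i j : ℕ) (hα : |ν| - 1 < α) (hβ : -1 < β) (hω : 0 < ω) :
    HasDerivAt (fun a => logPowMoment ν k ω i j a β n) (logPowMoment ν k ω (i + 1) j α β n) α := by
  simp only [logPowMoment_eq_integral_Ioo, logPowIntegrand]
  exact hasDerivAt_integral_log_pow_mul_rpow_smul_smul aemeasurable_id
    ae_mem_Ioc_and_one_sub_mem_Ioc.1 (by fun_prop) ae_mem_Ioc_and_one_sub_mem_Ioc.2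
    (fun a b ha hb => integrableOn_rpow_smul_momentFactor k n ha hb hω) i j hα hβ

theorem hasDerivAt_logPowMoment_right (i j : ℕ) (hα : |ν| - 1 < α) (hβ : -1 < β) (hω : 0 < ω) :
    HasDerivAt (fun b => logPowMoment ν k ω i j α b n) (logPowMoment ν k ω i (j + 1) α β n) β := by
  simp only [logPowMoment_eq_integral_Ioo, logPowIntegrand,
    smul_comm (Real.log _ ^ i * _ : ℝ)]
  refine hasDerivAt_integral_log_pow_mul_rpow_smul_smul (by fun_prop)
    ae_mem_Ioc_and_one_sub_mem_Ioc.2 aemeasurable_id ae_mem_Ioc_and_one_sub_mem_Ioc.1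
    (fun b a hb ha => ?_) j i hβ hα
  simpa only [smul_comm (_ ^ a)] using! integrableOn_rpow_smul_momentFactor k n ha hb hω

end Moments

/-! ### Shifted Chebyshev polynomials -/

/-- Shifted Chebyshev polynomial of the second kind, as a function on `[0, 1]`; it carries the
derivative of `shiftedChebyshevT`. -/
def shiftedChebyshevU (n : ℤ) (x : ℝ) : ℝ := (Polynomial.Chebyshev.U ℝ n).eval (2 * x - 1)

theorem continuous_shiftedChebyshevU (n : ℤ) : Continuous (shiftedChebyshevU n) := by
  unfold shiftedChebyshevU
  fun_prop

theorem shiftedChebyshevT_add_two (n : ℤ) (x : ℝ) :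
    shiftedChebyshevT (n + 2) x
      = 2 * (2 * x - 1) * shiftedChebyshevT (n + 1) x - shiftedChebyshevT n x := by
  simp only [shiftedChebyshevT, Polynomial.Chebyshev.T_add_two, Polynomial.eval_sub,
    Polynomial.eval_mul, Polynomial.eval_X, Polynomial.eval_ofNat]

theorem shiftedChebyshevT_sub_two (n : ℤ) (x : ℝ) :
    shiftedChebyshevT (n - 2) x
      = 2 * (2 * x - 1) * shiftedChebyshevT (n - 1) x - shiftedChebyshevT n x := by
  simp only [shiftedChebyshevT, Polynomial.Chebyshev.T_sub_two, Polynomial.eval_sub,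
    Polynomial.eval_mul, Polynomial.eval_X, Polynomial.eval_ofNat]

theorem shiftedChebyshevT_add_one (n : ℤ) (x : ℝ) :
    shiftedChebyshevT (n + 1) x
      = (2 * x - 1) * shiftedChebyshevT n x - 4 * x * (1 - x) * shiftedChebyshevU (n - 1) x := by
  have hTU := Polynomial.Chebyshev.T_eq_X_mul_T_sub_pol_U ℝ (n - 1)
  rw [sub_add_cancel, sub_add_eq_add_sub, add_sub_assoc, show (2 : ℤ) - 1 = 1 by norm_num] at hTU
  simp only [shiftedChebyshevT, shiftedChebyshevU, hTU, Polynomial.eval_sub, Polynomial.eval_mul,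
    Polynomial.eval_X, Polynomial.eval_one, Polynomial.eval_pow]
  ring

theorem shiftedChebyshevT_sub_one (n : ℤ) (x : ℝ) :
    shiftedChebyshevT (n - 1) x
      = (2 * x - 1) * shiftedChebyshevT n x + 4 * x * (1 - x) * shiftedChebyshevU (n - 1) x := by
  have hadd := shiftedChebyshevT_add_two (n - 1) x
  rw [sub_add_cancel, show n - 1 + 2 = n + 1 by ring] at hadd
  linear_combination hadd - shiftedChebyshevT_add_one n x

theorem hasDerivAt_shiftedChebyshevT (n : ℤ) (x : ℝ) :
    HasDerivAt (shiftedChebyshevT n) (2 * n * shiftedChebyshevU (n - 1) x) x := by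
  have h := ((Polynomial.Chebyshev.T ℝ n).hasDerivAt (2 * x - 1)).comp x
    (((hasDerivAt_id x).const_mul 2).sub_const 1)
  convert! h using 1
  simp only [Polynomial.Chebyshev.T_derivative_eq_U, Polynomial.eval_mul, Polynomial.eval_intCast,
    shiftedChebyshevU]
  ring

theorem exists_hasDerivAt_shiftedChebyshevU (n : ℤ) (x : ℝ) :
    ∃ t₂, HasDerivAt (fun x => 2 * n * shiftedChebyshevU (n - 1) x) t₂ x ∧
      x * (1 - x) * t₂
        = (2 * x - 1) * (n * shiftedChebyshevU (n - 1) x) - n ^ 2 * shiftedChebyshevT n x := by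
  have hderiv : ∀ y, (Polynomial.derivative (Polynomial.Chebyshev.T ℝ n)).eval (2 * y - 1)
      = n * shiftedChebyshevU (n - 1) y := fun y => by
    rw [Polynomial.Chebyshev.T_derivative_eq_U, Polynomial.eval_mul, Polynomial.eval_intCast,
      shiftedChebyshevU]
  have h := ((Polynomial.derivative (Polynomial.Chebyshev.T ℝ n)).hasDerivAt (2 * x - 1)).comp x
    (((hasDerivAt_id x).const_mul 2).sub_const 1)
  have hode := congrArg (Polynomial.eval (2 * x - 1))
    (Polynomial.Chebyshev.one_sub_X_sq_mul_derivative_derivative_T_eq_poly_in_T (R := ℝ) n)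
  simp only [Function.iterate_succ, Function.iterate_zero, Function.comp_apply, id_eq,
    Polynomial.eval_mul, Polynomial.eval_sub, Polynomial.eval_one, Polynomial.eval_pow,
    Polynomial.eval_X, Polynomial.eval_intCast, hderiv] at hode
  refine ⟨_, (h.const_mul 2).congr_of_eventuallyEq (Eventually.of_forall fun y => ?_), ?_⟩
  · simp only [Function.comp_apply, id_eq, hderiv, mul_assoc]
  · rw [shiftedChebyshevT]
    linear_combination hode

/-! ### The homogeneous recurrence -/

/-- The oscillatory Jacobi weight of the moment integrand. -/
def oscWeight (k a b x : ℝ) : ℂ :=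
  ((x ^ a * (1 - x) ^ b : ℝ) : ℂ) * Complex.exp (Complex.I * (2 * k * x))

/-- `x * (1 - x)` times the logarithmic derivative of `oscWeight k (a + 1) (b + 1)`. -/
def oscLogDeriv (k a b x : ℝ) : ℂ :=
  (a + 1) * (1 - x) - (b + 1) * x + 2 * Complex.I * k * x * (1 - x)

theorem hasDerivAt_oscLogDeriv (k a b x : ℝ) :
    HasDerivAt (oscLogDeriv k a b)
      (-(a + 1) - (b + 1) + 2 * Complex.I * k * (1 - 2 * x)) x := by
  have hid : HasDerivAt (fun x : ℝ => (x : ℂ)) 1 x := Complex.ofRealCLM.hasDerivAt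
  have hsub := hid.const_sub 1
  convert! ((hsub.const_mul (a + 1 : ℂ)).sub (hid.const_mul (b + 1 : ℂ))).add
    ((hid.const_mul (2 * Complex.I * k)).mul hsub) using 1
  ring

theorem hasDerivAt_oscWeight_mul {k a b x : ℝ} (hx : x ∈ Ioo (0 : ℝ) 1) {f : ℝ → ℂ} {f' : ℂ}
    (hf : HasDerivAt f f' x) :
    HasDerivAt (fun x => oscWeight k (a + 1) (b + 1) x * f x)
      (oscWeight k a b x * (oscLogDeriv k a b x * f x + x * (1 - x) * f')) x := by
  have hx0 : x ≠ 0 := hx.1.ne'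
  have hx1 : 1 - x ≠ 0 := (sub_pos.2 hx.2).ne'
  have hpow := (((hasDerivAt_id x).rpow_const (p := a + 1) (Or.inl hx0)).mul
    (((hasDerivAt_id x).const_sub 1).rpow_const (p := b + 1) (Or.inl hx1))).ofReal_comp
  have hexp : HasDerivAt (fun x : ℝ => Complex.exp (Complex.I * (2 * k * x)))
      (Complex.exp (Complex.I * (2 * k * x)) * (Complex.I * (2 * k * 1))) x :=
    ((Complex.ofRealCLM.hasDerivAt.const_mul (2 * k : ℂ)).const_mul Complex.I).cexp
  convert! (hpow.mul hexp).mul hf using 1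
  simp only [oscWeight, oscLogDeriv, id_eq, add_sub_cancel_right, Real.rpow_add_one hx0,
    Real.rpow_add_one hx1, Pi.mul_apply]
  push_cast
  ring

theorem tendsto_rpow_smul_nhdsGT_zero {E : Type*} [NormedAddCommGroup E] [NormedSpace ℝ E]
    {φ : ℝ → E} {ρ a : ℝ} (hφ : φ =O[𝓝[>] 0] fun x => x ^ (-ρ)) (ha : ρ < a) :
    Tendsto (fun x => x ^ a • φ x) (𝓝[>] 0) (𝓝 0) := by
  refine ((isBigO_refl (fun x : ℝ => x ^ a) _).smul hφ).trans_tendsto ?_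
  have h0 : Tendsto (fun x : ℝ => x ^ (a - ρ)) (𝓝[>] 0) (𝓝 0) := by
    have hcont := (Real.continuousAt_rpow_const 0 (a - ρ) (Or.inr (sub_pos.2 ha).le)).tendsto
    rw [Real.zero_rpow (sub_pos.2 ha).ne'] at hcont
    exact hcont.mono_left nhdsWithin_le_nhds
  refine h0.congr' ?_
  filter_upwards [self_mem_nhdsWithin] with x hx
  rw [smul_eq_mul, ← Real.rpow_add hx, sub_eq_add_neg]

theorem tendsto_oscWeight_mul_nhdsGT_zero {k a b ρ : ℝ} {φ : ℝ → ℂ}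
    (hφ : φ =O[𝓝[>] 0] fun x => x ^ (-ρ)) (ha : ρ < a) :
    Tendsto (fun x => oscWeight k a b x * φ x) (𝓝[>] 0) (𝓝 0) := by
  have hcont : ContinuousAt
      (fun x : ℝ => (((1 - x) ^ b : ℝ) : ℂ) * Complex.exp (Complex.I * (2 * k * x))) 0 := by
    refine ContinuousAt.mul (Complex.continuous_ofReal.continuousAt.comp ?_) (by fun_prop)
    exact (continuousAt_const.sub continuousAt_id).rpow_const (Or.inl (by norm_num))
  have h := (hcont.tendsto.mono_left nhdsWithin_le_nhds).mul (tendsto_rpow_smul_nhdsGT_zero hφ ha)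
  rw [mul_zero] at h
  refine h.congr fun x => ?_
  rw [oscWeight, Complex.real_smul]
  push_cast
  ring

theorem tendsto_oscWeight_mul_nhdsLT_one {k a b : ℝ} {φ : ℝ → ℂ} (hφ : ContinuousAt φ 1)
    (hb : 0 < b) : Tendsto (fun x => oscWeight k a b x * φ x) (𝓝[<] 1) (𝓝 0) := by
  have hpow : ContinuousAt (fun x : ℝ => x ^ a * (1 - x) ^ b) 1 :=
    (Real.continuousAt_rpow_const 1 a (Or.inl one_ne_zero)).mul
      ((continuousAt_const.sub continuousAt_id).rpow_const (Or.inr hb.le))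
  have hcont : ContinuousAt (fun x => oscWeight k a b x * φ x) 1 :=
    ((Complex.continuous_ofReal.continuousAt.comp hpow).mul (by fun_prop)).mul hφ
  have h0 : oscWeight k a b 1 * φ 1 = 0 := by
    rw [oscWeight, sub_self, Real.zero_rpow hb.ne', mul_zero, Complex.ofReal_zero, zero_mul,
      zero_mul]
  exact h0 ▸ hcont.tendsto.mono_left nhdsWithin_le_nhds

theorem exists_nineTerm_eq_sum (ν k ω α β : ℝ) (n : ℤ) :
    ∃ (c : Fin 9 → ℂ) (m : Fin 9 → ℤ), ∀ S, nineTerm ν k ω α β S n = ∑ j, c j * S (m j) := by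
  refine ⟨![1 / 16 * ω ^ 2 - 1 / 4 * k ^ 2, recCoeff1 k α β n, recCoeff2 ν k ω α β n,
    recCoeff3 ν k α β n, recCoeff4 ν k ω α β n, recCoeff3 ν k α β (-n),
    recCoeff2 ν k ω α β (-n), recCoeff1 k α β (-n), 1 / 16 * ω ^ 2 - 1 / 4 * k ^ 2],
    ![n + 4, n + 3, n + 2, n + 1, n, n - 1, n - 2, n - 3, n - 4], fun S => ?_⟩
  simp only [nineTerm, Fin.sum_univ_succ, Fin.sum_univ_zero, Matrix.cons_val_zero,
    Matrix.cons_val_succ, add_assoc, add_zero]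

theorem nineTerm_const_mul (ν k ω α β : ℝ) (c : ℂ) (S : ℤ → ℂ) (n : ℤ) :
    nineTerm ν k ω α β (fun m => c * S m) n = c * nineTerm ν k ω α β S n := by
  simp only [nineTerm]
  ring

theorem intervalIntegrable_nineTerm (ν k ω α β : ℝ) {F : ℤ → ℝ → ℂ}
    {a b : ℝ} (hF : ∀ m, IntervalIntegrable (F m) volume a b) (n : ℤ) :
    IntervalIntegrable (fun x => nineTerm ν k ω α β (fun m => F m x) n) volume a b := by
  obtain ⟨c, m, hsum⟩ := exists_nineTerm_eq_sum ν k ω α β n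
  simp only [hsum]
  simpa only [Finset.sum_fn] using
    IntervalIntegrable.sum Finset.univ fun j _ => (hF (m j)).const_mul (c j)

theorem integral_nineTerm (ν k ω α β : ℝ) {F : ℤ → ℝ → ℂ} {a b : ℝ}
    (hF : ∀ m, IntervalIntegrable (F m) volume a b) (n : ℤ) :
    ∫ x in a..b, nineTerm ν k ω α β (fun m => F m x) n
      = nineTerm ν k ω α β (fun m => ∫ x in a..b, F m x) n := by
  obtain ⟨c, m, hsum⟩ := exists_nineTerm_eq_sum ν k ω α β n
  simp only [hsum, intervalIntegral.integral_finsetSum fun j _ => (hF (m j)).const_mul (c j),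
    intervalIntegral.integral_const_mul]

theorem nineTerm_shiftedChebyshevT (ν k ω α β : ℝ) (n : ℤ) (x : ℝ) {t₁ t₂ : ℝ}
    (ht₁ : t₁ = 2 * n * shiftedChebyshevU (n - 1) x)
    (ht₂ : x * (1 - x) * t₂
      = (2 * x - 1) * (n * shiftedChebyshevU (n - 1) x) - n ^ 2 * shiftedChebyshevT n x) :
    nineTerm ν k ω α β (fun m => (shiftedChebyshevT m x : ℂ)) n
      = 16 * (oscLogDeriv k α β x *
            (oscLogDeriv k α (β + 1) x * shiftedChebyshevT n x + x * (1 - x) * t₁)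
          + x * (1 - x) *
            ((-(α + 1) - (β + 1 + 1) + 2 * Complex.I * k * (1 - 2 * x)) * shiftedChebyshevT n x
              + oscLogDeriv k α (β + 1) x * t₁ + ((1 - 2 * x) * t₁ + x * (1 - x) * t₂))
          - (ν ^ 2 - (ω * x) ^ 2) * (1 - x) ^ 2 * shiftedChebyshevT n x) := by
  have up3 := by simpa only [add_assoc, Int.reduceAdd] using shiftedChebyshevT_add_two (n + 1) x
  have up4 := by simpa only [add_assoc, Int.reduceAdd] using shiftedChebyshevT_add_two (n + 2) x
  have down3 := by simpa only [sub_sub, Int.reduceAdd] using shiftedChebyshevT_sub_two (n - 1) x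
  have down4 := by simpa only [sub_sub, Int.reduceAdd] using shiftedChebyshevT_sub_two (n - 2) x
  have ht₂' : (x * (1 - x) * t₂ : ℂ)
      = (2 * x - 1) * (n * shiftedChebyshevU (n - 1) x) - n ^ 2 * shiftedChebyshevT n x := by
    exact_mod_cast ht₂
  simp only [nineTerm, recCoeff1, recCoeff2, recCoeff3, recCoeff4, oscLogDeriv, up4, up3,
    shiftedChebyshevT_add_two n, shiftedChebyshevT_add_one n, down4, down3,
    shiftedChebyshevT_sub_two n, shiftedChebyshevT_sub_one n, ht₁]
  push_cast
  linear_combination (-16 * x * (1 - x)) * ht₂'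
    + (-64 * k ^ 2 * shiftedChebyshevT n x * x ^ 2 * (1 - x) ^ 2) * Complex.I_sq

section LagrangeIdentity

variable {ν ω ρ : ℝ} {h w : ℝ → ℂ}

/-- The bilinear concomitant `16 (h θu - (θh) u)`, where `θ = x d/dx` and
`u = x ^ (α + 1) (1 - x) ^ (β + 2) exp (2 i k x) T_n`; the function `w` stands for `θh`. -/
def concomitant (k α β : ℝ) (n : ℤ) (h w : ℝ → ℂ) (x : ℝ) : ℂ :=
  16 * (h x * (oscWeight k (α + 1) (β + 1) x *
      (oscLogDeriv k α (β + 1) x * shiftedChebyshevT n x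
        + x * (1 - x) * ((2 * n * shiftedChebyshevU (n - 1) x : ℝ) : ℂ)))
    - w x * (oscWeight k (α + 1) (β + 1 + 1) x * shiftedChebyshevT n x))

theorem oscWeight_add_one_right (k a b : ℝ) {x : ℝ} (hx : 1 - x ≠ 0) :
    oscWeight k a (b + 1) x = (1 - x) * oscWeight k a b x := by
  rw [oscWeight, oscWeight, Real.rpow_add_one hx]
  push_cast
  ring

theorem oscWeight_add_one_left (k a b : ℝ) {x : ℝ} (hx : x ≠ 0) :
    oscWeight k (a + 1) b x = x * oscWeight k a b x := by
  rw [oscWeight, oscWeight, Real.rpow_add_one hx]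
  push_cast
  ring

theorem hasDerivAt_concomitant (k α β : ℝ) (n : ℤ) (hh : IsBesselSolution ν ω ρ (fun _ => 0) h w)
    {x : ℝ} (hx : x ∈ Ioo (0 : ℝ) 1) :
    HasDerivAt (concomitant k α β n h w)
      (oscWeight k α β x * h x * nineTerm ν k ω α β (fun m => (shiftedChebyshevT m x : ℂ)) n)
      x := by
  have hx0 : x ≠ 0 := hx.1.ne'
  have hx1 : 1 - x ≠ 0 := (sub_pos.2 hx.2).ne'
  obtain ⟨t₂, hT₂, hode⟩ := exists_hasDerivAt_shiftedChebyshevU n x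
  have hid : HasDerivAt (fun x : ℝ => (x : ℂ)) 1 x := Complex.ofRealCLM.hasDerivAt
  have hT := (hasDerivAt_shiftedChebyshevT n x).ofReal_comp
  have hB := ((hasDerivAt_oscLogDeriv k α (β + 1) x).mul hT).add
    ((hid.mul (hid.const_sub 1)).mul hT₂.ofReal_comp)
  have hC := (((hh.hasDerivAt x hx.1).mul (hasDerivAt_oscWeight_mul (k := k) (a := α) (b := β)
    hx hB)).sub ((hh.hasDerivAt_theta x hx.1).mul (hasDerivAt_oscWeight_mul (k := k) (a := α)
    (b := β + 1) hx hT))).const_mul 16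
  convert! hC using 1
  have hx0' : (x : ℂ) ≠ 0 := Complex.ofReal_ne_zero.2 hx0
  simp only [nineTerm_shiftedChebyshevT ν k ω α β n x rfl hode, oscWeight_add_one_right _ _ _ hx1,
    oscWeight_add_one_left _ _ _ hx0, Complex.real_smul, add_zero, Pi.mul_apply, Pi.add_apply]
  push_cast
  field_simp
  ring

theorem concomitant_eq_oscWeight_mul (k α β : ℝ) (n : ℤ) (h w : ℝ → ℂ) {x : ℝ} (hx : 1 - x ≠ 0) :
    concomitant k α β n h w x = oscWeight k (α + 1) (β + 1) x *
      (h x * (16 * (oscLogDeriv k α (β + 1) x * shiftedChebyshevT n x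
          + x * (1 - x) * ((2 * n * shiftedChebyshevU (n - 1) x : ℝ) : ℂ)))
        - w x * (16 * ((1 - x) * shiftedChebyshevT n x))) := by
  rw [concomitant, oscWeight_add_one_right k (α + 1) (β + 1) hx]
  ring

theorem tendsto_concomitant_nhdsGT_zero {k α β : ℝ} (n : ℤ) {s : ℝ → ℂ}
    (hh : IsBesselSolution ν ω ρ s h w) (hρ : ρ < α + 1) :
    Tendsto (concomitant k α β n h w) (𝓝[>] 0) (𝓝 0) := by
  have hT := continuous_shiftedChebyshevT n
  have hU := continuous_shiftedChebyshevU (n - 1)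
  have hc₁ : Continuous fun x : ℝ => 16 * (oscLogDeriv k α (β + 1) x * shiftedChebyshevT n x
      + x * (1 - x) * ((2 * n * shiftedChebyshevU (n - 1) x : ℝ) : ℂ)) := by
    unfold oscLogDeriv
    fun_prop
  have hc₂ : Continuous fun x : ℝ => 16 * ((1 - x) * shiftedChebyshevT n x : ℂ) := by fun_prop
  have hO := (hh.isBigO.mul (isBigO_one_nhdsGT_of_continuous hc₁ 0)).sub
    (hh.isBigO_theta.mul (isBigO_one_nhdsGT_of_continuous hc₂ 0))
  simp only [mul_one] at hO
  refine (tendsto_oscWeight_mul_nhdsGT_zero (k := k) (b := β + 1) hO hρ).congr' ?_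
  filter_upwards [Ioo_mem_nhdsGT zero_lt_one] with x hx
  rw [concomitant_eq_oscWeight_mul _ _ _ _ _ _ (sub_pos.2 hx.2).ne']

theorem tendsto_concomitant_nhdsLT_one {k α β : ℝ} (n : ℤ) {s : ℝ → ℂ}
    (hh : IsBesselSolution ν ω ρ s h w) (hβ : -1 < β) :
    Tendsto (concomitant k α β n h w) (𝓝[<] 1) (𝓝 0) := by
  have hT := continuous_shiftedChebyshevT n
  have hU := continuous_shiftedChebyshevU (n - 1)
  have hh₁ := (hh.hasDerivAt 1 one_pos).continuousAt
  have hw₁ := (hh.hasDerivAt_theta 1 one_pos).continuousAt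
  refine (tendsto_oscWeight_mul_nhdsLT_one (k := k) (a := α + 1) (b := β + 1)
    (φ := fun x => h x * (16 * (oscLogDeriv k α (β + 1) x * shiftedChebyshevT n x
          + x * (1 - x) * ((2 * n * shiftedChebyshevU (n - 1) x : ℝ) : ℂ)))
        - w x * (16 * ((1 - x) * shiftedChebyshevT n x))) ?_ (by linarith)).congr' ?_
  · unfold oscLogDeriv
    fun_prop
  · filter_upwards [self_mem_nhdsWithin] with x hx
    rw [concomitant_eq_oscWeight_mul _ _ _ _ _ _ (sub_pos.2 hx).ne']

theorem integral_oscWeight_mul_nineTerm_eq_zero {k α β : ℝ} (n : ℤ)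
    (hh : IsBesselSolution ν ω ρ (fun _ => 0) h w) (hρ : ρ < α + 1) (hβ : -1 < β)
    (hint : IntervalIntegrable (fun x => oscWeight k α β x * h x *
      nineTerm ν k ω α β (fun m => (shiftedChebyshevT m x : ℂ)) n) volume 0 1) :
    ∫ x in (0 : ℝ)..1, oscWeight k α β x * h x *
      nineTerm ν k ω α β (fun m => (shiftedChebyshevT m x : ℂ)) n = 0 := by
  rw [intervalIntegral.integral_eq_sub_of_hasDerivAt_of_tendsto zero_lt_one
    (fun x hx => hasDerivAt_concomitant k α β n hh hx) hint
    (tendsto_concomitant_nhdsGT_zero n hh hρ) (tendsto_concomitant_nhdsLT_one n hh hβ), sub_self]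

end LagrangeIdentity

theorem nineTerm_momentIntegrand (ν k ω α β : ℝ) (n : ℤ) (x : ℝ) :
    nineTerm ν k ω α β (fun m => momentIntegrand ν k ω α β m x) n =
      oscWeight k α β x * hankelH1 ν (ω * x) *
        nineTerm ν k ω α β (fun m => (shiftedChebyshevT m x : ℂ)) n := by
  rw [← nineTerm_const_mul]
  congr 1
  ext m
  rw [momentIntegrand, oscWeight]
  push_cast
  ring

theorem nineTerm_moment {ν ω α β : ℝ} (k : ℝ) (hα : |ν| - 1 < α) (hβ : -1 < β) (hω : 0 < ω)
    (n : ℤ) : nineTerm ν k ω α β (moment ν k ω α β) n = 0 := by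
  obtain ⟨ρ, hνρ, hρα⟩ := exists_between (sub_lt_iff_lt_add.1 hα)
  obtain ⟨w, hw⟩ := exists_isBesselSolution_hankelH1 hνρ
  have hsol := hw.comp_const_mul hω
  rw [one_mul] at hsol
  have hmoment : ∀ m, IntervalIntegrable (momentIntegrand ν k ω α β m) volume 0 1 := fun m => by
    simpa only [pow_zero, one_mul] using! intervalIntegrable_log_pow_mul_momentIntegrand k m 0 0
      hα hβ hω
  have hint := intervalIntegrable_nineTerm ν k ω α β hmoment n
  have heq := integral_nineTerm ν k ω α β hmoment n
  simp only [nineTerm_momentIntegrand] at hint heq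
  exact heq.symm.trans (integral_oscWeight_mul_nineTerm_eq_zero n hsol hρα hβ hint)

/-! ### Differentiating the recurrence -/

section Differentiation

variable {a b : ℝ → ℝ} {a' b' t : ℝ}

theorem hasDerivAt_of_eq_quadratic {f : ℝ → ℂ} {c₀ c₁ c₂ c₃ c₄ c₅ : ℂ} (ha : HasDerivAt a a' t)
    (hb : HasDerivAt b b' t)
    (hf : ∀ s, f s = c₀ + c₁ * a s + c₂ * b s + c₃ * a s ^ 2 + c₄ * (a s * b s) + c₅ * b s ^ 2) :
    HasDerivAt f ((c₁ + 2 * c₃ * a t + c₄ * b t) * a' + (c₂ + c₄ * a t + 2 * c₅ * b t) * b') t := by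
  have hA := ha.ofReal_comp
  have hB := hb.ofReal_comp
  rw [funext hf]
  convert! (((((hA.const_mul c₁).const_add c₀).add (hB.const_mul c₂)).add
    ((hA.pow 2).const_mul c₃)).add ((hA.mul hB).const_mul c₄)).add ((hB.pow 2).const_mul c₅) using 1
  push_cast
  ring

theorem hasDerivAt_recCoeff1 (k : ℝ) (ha : HasDerivAt a a' t) (hb : HasDerivAt b b' t) (n : ℤ) :
    HasDerivAt (fun s => recCoeff1 k (a s) (b s) n) (Complex.I * k * (a' + b')) t := by
  convert! hasDerivAt_of_eq_quadratic (c₀ := recCoeff1 k 0 0 n) (c₁ := Complex.I * k)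
    (c₂ := Complex.I * k) (c₃ := 0) (c₄ := 0) (c₅ := 0) ha hb fun s => ?_ using 1
  · ring
  · simp only [recCoeff1]
    push_cast
    ring

theorem hasDerivAt_recCoeff2 (ν k ω : ℝ) (ha : HasDerivAt a a' t) (hb : HasDerivAt b b' t)
    (n : ℤ) :
    HasDerivAt (fun s => recCoeff2 ν k ω (a s) (b s) n)
      ((6 + 2 * b t + 2 * n + 2 * a t - 2 * Complex.I * k) * a'
        + (6 + 2 * b t + 2 * n + 2 * a t + 2 * Complex.I * k) * b') t := by
  convert! hasDerivAt_of_eq_quadratic (c₀ := recCoeff2 ν k ω 0 0 n)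
    (c₁ := 6 + 2 * n - 2 * Complex.I * k) (c₂ := 6 + 2 * n + 2 * Complex.I * k) (c₃ := 1)
    (c₄ := 2) (c₅ := 1) ha hb fun s => ?_ using 1
  · ring
  · simp only [recCoeff2]
    push_cast
    ring

theorem hasDerivAt_recCoeff3 (ν k : ℝ) (ha : HasDerivAt a a' t) (hb : HasDerivAt b b' t) (n : ℤ) :
    HasDerivAt (fun s => recCoeff3 ν k (a s) (b s) n)
      (-(8 + Complex.I * k + 4 * n + 8 * a t) * a'
        + (12 - Complex.I * k + 4 * n + 8 * b t) * b') t := by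
  convert! hasDerivAt_of_eq_quadratic (c₀ := recCoeff3 ν k 0 0 n)
    (c₁ := -(8 + Complex.I * k + 4 * n)) (c₂ := 12 - Complex.I * k + 4 * n) (c₃ := -4) (c₄ := 0)
    (c₅ := 4) ha hb fun s => ?_ using 1
  · ring
  · simp only [recCoeff3]
    push_cast
    ring

theorem hasDerivAt_recCoeff4 (ν k ω : ℝ) (ha : HasDerivAt a a' t) (hb : HasDerivAt b b' t)
    (n : ℤ) :
    HasDerivAt (fun s => recCoeff4 ν k ω (a s) (b s) n)
      ((4 - 4 * b t + 4 * Complex.I * k + 12 * a t) * a'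
        + (12 - 4 * a t - 4 * Complex.I * k + 12 * b t) * b') t := by
  convert! hasDerivAt_of_eq_quadratic (c₀ := recCoeff4 ν k ω 0 0 n) (c₁ := 4 + 4 * Complex.I * k)
    (c₂ := 12 - 4 * Complex.I * k) (c₃ := 6) (c₄ := -4) (c₅ := 6) ha hb fun s => ?_ using 1
  · ring
  · simp only [recCoeff4]
    push_cast
    ring

theorem hasDerivAt_nineTerm (ν k ω : ℝ) (ha : HasDerivAt a a' t) (hb : HasDerivAt b b' t)
    {S : ℝ → ℤ → ℂ} {S' : ℤ → ℂ} (hS : ∀ m, HasDerivAt (fun s => S s m) (S' m) t) (n : ℤ) :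
    HasDerivAt (fun s => nineTerm ν k ω (a s) (b s) (S s) n)
      (nineTerm ν k ω (a t) (b t) S' n - a' * logRhs1 k (a t) (b t) (S t) n
        - b' * logRhs2 k (a t) (b t) (S t) n) t := by
  have h₀ := fun m => (hS m).const_mul (1 / 16 * ω ^ 2 - 1 / 4 * k ^ 2 : ℂ)
  have h₁ := fun n m => (hasDerivAt_recCoeff1 k ha hb n).mul (hS m)
  have h₂ := fun n m => (hasDerivAt_recCoeff2 ν k ω ha hb n).mul (hS m)
  have h₃ := fun n m => (hasDerivAt_recCoeff3 ν k ha hb n).mul (hS m)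
  have h₄ := (hasDerivAt_recCoeff4 ν k ω ha hb n).mul (hS n)
  convert! ((((((((h₀ (n + 4)).add (h₁ n (n + 3))).add (h₂ n (n + 2))).add (h₃ n (n + 1))).add
    h₄).add (h₃ (-n) (n - 1))).add (h₂ (-n) (n - 2))).add (h₁ (-n) (n - 3))).add (h₀ (n - 4))
    using 1
  simp only [nineTerm, logRhs1, logRhs2]
  push_cast
  ring

theorem hasDerivAt_logRhs2_left (k : ℝ) {α β : ℝ} {S : ℝ → ℤ → ℂ} {S' : ℤ → ℂ}
    (hS : ∀ m, HasDerivAt (fun a => S a m) (S' m) α) (n : ℤ) :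
    HasDerivAt (fun a => logRhs2 k a β (S a) n)
      (logRhs2 k α β S' n - (2 * S α (n + 2) - 4 * S α n + 2 * S α (n - 2))) α := by
  have hid : HasDerivAt (fun a : ℝ => (a : ℂ)) 1 α := Complex.ofRealCLM.hasDerivAt
  have h₂ := fun n : ℤ =>
    ((hid.const_mul 2).const_add (6 + 2 * β + 2 * n : ℂ)).add_const (2 * Complex.I * k)
  have h₄ := (((hid.const_mul 4).const_sub 12).sub_const (4 * Complex.I * k)).add_const (12 * β : ℂ)
  have h := (((((((hS (n + 3)).const_mul (Complex.I * k)).add ((h₂ n).mul (hS (n + 2)))).add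
    ((hS (n + 1)).const_mul (12 - Complex.I * k + 4 * n + 8 * β))).add (h₄.mul (hS n))).add
    ((hS (n - 1)).const_mul (12 - Complex.I * k - 4 * n + 8 * β))).add
    ((h₂ (-n)).mul (hS (n - 2)))).add ((hS (n - 3)).const_mul (Complex.I * k))
  convert! h.neg using 1
  · ext a
    simp only [logRhs2, Pi.neg_apply, Pi.add_apply, Pi.mul_apply]
    push_cast
    ring
  · simp only [logRhs2]
    push_cast
    ring

end Differentiation

section LogMoments

variable {ν ω α β : ℝ} (k : ℝ) (hα : |ν| - 1 < α) (hβ : -1 < β) (hω : 0 < ω) (n : ℤ)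
include hα hβ hω

theorem hasDerivAt_moment_left :
    HasDerivAt (fun a => moment ν k ω a β n) (logMoment1 ν k ω α β n) α := by
  simpa only [logPowMoment_zero_zero, zero_add, logPowMoment_one_zero] using
    hasDerivAt_logPowMoment_left k n 0 0 hα hβ hω

theorem hasDerivAt_moment_right :
    HasDerivAt (fun b => moment ν k ω α b n) (logMoment2 ν k ω α β n) β := by
  simpa only [logPowMoment_zero_zero, zero_add, logPowMoment_zero_one] using
    hasDerivAt_logPowMoment_right k n 0 0 hα hβ hω

theorem hasDerivAt_logMoment2_left :
    HasDerivAt (fun a => logMoment2 ν k ω a β n) (logMoment3 ν k ω α β n) α := by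
  simpa only [logPowMoment_zero_one, zero_add, logPowMoment_one_one] using
    hasDerivAt_logPowMoment_left k n 0 1 hα hβ hω

theorem hasDerivAt_logMoment1_right :
    HasDerivAt (fun b => logMoment1 ν k ω α b n) (logMoment3 ν k ω α β n) β := by
  simpa only [logPowMoment_one_zero, zero_add, logPowMoment_one_one] using
    hasDerivAt_logPowMoment_right k n 1 0 hα hβ hω

theorem nineTerm_logMoment1 :
    nineTerm ν k ω α β (logMoment1 ν k ω α β) n = logRhs1 k α β (moment ν k ω α β) n := by
  have h := hasDerivAt_nineTerm ν k ω (hasDerivAt_id α) (hasDerivAt_const α β)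
    (S := fun a => moment ν k ω a β) (fun m => hasDerivAt_moment_left k hα hβ hω m) n
  have h₀ : HasDerivAt (fun a => nineTerm ν k ω a β (moment ν k ω a β) n) 0 α :=
    (hasDerivAt_const α (0 : ℂ)).congr_of_eventuallyEq
      (by filter_upwards [lt_mem_nhds hα] with a ha using nineTerm_moment k ha hβ hω n)
  simpa only [Complex.ofReal_one, Complex.ofReal_zero, one_mul, zero_mul, sub_zero, sub_eq_zero,
    id_eq] using h.unique h₀

theorem nineTerm_logMoment2 :
    nineTerm ν k ω α β (logMoment2 ν k ω α β) n = logRhs2 k α β (moment ν k ω α β) n := by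
  have h := hasDerivAt_nineTerm ν k ω (hasDerivAt_const β α) (hasDerivAt_id β)
    (S := fun b => moment ν k ω α b) (fun m => hasDerivAt_moment_right k hα hβ hω m) n
  have h₀ : HasDerivAt (fun b => nineTerm ν k ω α b (moment ν k ω α b) n) 0 β :=
    (hasDerivAt_const β (0 : ℂ)).congr_of_eventuallyEq
      (by filter_upwards [lt_mem_nhds hβ] with b hb using nineTerm_moment k hα hb hω n)
  simpa only [Complex.ofReal_one, Complex.ofReal_zero, one_mul, zero_mul, sub_zero, sub_eq_zero,
    id_eq] using h.unique h₀

theorem nineTerm_logMoment3 :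
    nineTerm ν k ω α β (logMoment3 ν k ω α β) n
      = logRhs3 k α β (moment ν k ω α β) (logMoment1 ν k ω α β) (logMoment2 ν k ω α β) n := by
  have h := hasDerivAt_nineTerm ν k ω (hasDerivAt_id α) (hasDerivAt_const α β)
    (S := fun a => logMoment2 ν k ω a β) (fun m => hasDerivAt_logMoment2_left k hα hβ hω m) n
  have h₂ := hasDerivAt_logRhs2_left k (β := β) (S := fun a => moment ν k ω a β)
    (fun m => hasDerivAt_moment_left k hα hβ hω m) n
  have heq := h.unique (h₂.congr_of_eventuallyEq
    (by filter_upwards [lt_mem_nhds hα] with a ha using nineTerm_logMoment2 k ha hβ hω n))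
  simp only [Complex.ofReal_one, Complex.ofReal_zero, one_mul, zero_mul, sub_zero, id_eq] at heq
  rw [sub_eq_iff_eq_add.1 heq]
  simp only [logRhs1, logRhs2, logRhs3]
  ring

end LogMoments

end

theorem mainTheorem2_general (ν k ω α β : ℝ) (hα : -1 < α - |ν|) (hβ : -1 < β)
    (hω : 0 < ω) :
    (∀ n : ℤ,
      IntervalIntegrable (fun x : ℝ => momentIntegrand ν k ω α β n x)
        MeasureTheory.volume 0 1 ∧
      IntervalIntegrable (fun x : ℝ => (Real.log x : ℂ) * momentIntegrand ν k ω α β n x)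
        MeasureTheory.volume 0 1 ∧
      IntervalIntegrable (fun x : ℝ => (Real.log (1 - x) : ℂ) * momentIntegrand ν k ω α β n x)
        MeasureTheory.volume 0 1 ∧
      IntervalIntegrable
        (fun x : ℝ =>
          (Real.log x : ℂ) * (Real.log (1 - x) : ℂ) * momentIntegrand ν k ω α β n x)
        MeasureTheory.volume 0 1) ∧
    (∀ n : ℤ,
      HasDerivAt (fun a : ℝ => moment ν k ω a β n) (logMoment1 ν k ω α β n) α ∧
      HasDerivAt (fun b : ℝ => moment ν k ω α b n) (logMoment2 ν k ω α β n) β ∧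
      HasDerivAt (fun a : ℝ => deriv (fun b : ℝ => moment ν k ω a b n) β)
        (logMoment3 ν k ω α β n) α ∧
      HasDerivAt (fun b : ℝ => deriv (fun a : ℝ => moment ν k ω a b n) α)
        (logMoment3 ν k ω α β n) β) ∧
    (∀ n : ℤ,
      nineTerm ν k ω α β (logMoment1 ν k ω α β) n
        = logRhs1 k α β (moment ν k ω α β) n ∧
      nineTerm ν k ω α β (logMoment2 ν k ω α β) n
        = logRhs2 k α β (moment ν k ω α β) n ∧
      nineTerm ν k ω α β (logMoment3 ν k ω α β) n
        = logRhs3 k α β (moment ν k ω α β) (logMoment1 ν k ω α β)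
            (logMoment2 ν k ω α β) n) := by
  replace hα : |ν| - 1 < α := by linarith
  have hint := fun n i j => intervalIntegrable_log_pow_mul_momentIntegrand k n i j hα hβ hω
  refine ⟨fun n => ⟨?_, ?_, ?_, ?_⟩, fun n => ⟨hasDerivAt_moment_left k hα hβ hω n,
      hasDerivAt_moment_right k hα hβ hω n,
      (hasDerivAt_logMoment2_left k hα hβ hω n).congr_of_eventuallyEq ?_,
      (hasDerivAt_logMoment1_right k hα hβ hω n).congr_of_eventuallyEq ?_⟩,
    fun n => ⟨nineTerm_logMoment1 k hα hβ hω n, nineTerm_logMoment2 k hα hβ hω n,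
      nineTerm_logMoment3 k hα hβ hω n⟩⟩
  · simpa only [pow_zero, one_mul] using hint n 0 0
  · simpa only [pow_zero, pow_one, mul_one] using hint n 1 0
  · simpa only [pow_zero, pow_one, one_mul] using hint n 0 1
  · simpa only [pow_one] using hint n 1 1
  · filter_upwards [lt_mem_nhds hα] with a ha using (hasDerivAt_moment_right k ha hβ hω n).deriv
  · filter_upwards [lt_mem_nhds hβ] with b hb using (hasDerivAt_moment_left k hα hb hω n).deriv

theorem mainTheorem2 (ν k ω α β : ℝ) (hα : -1 < α - |ν|) (hβ : -1 < β)
    (hk : 0 ≤ k) (hω : 0 < ω) :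
    -- all four integrals converge absolutely
    (∀ n : ℤ,
      IntervalIntegrable (fun x : ℝ => momentIntegrand ν k ω α β n x)
        MeasureTheory.volume 0 1 ∧
      IntervalIntegrable (fun x : ℝ => (Real.log x : ℂ) * momentIntegrand ν k ω α β n x)
        MeasureTheory.volume 0 1 ∧
      IntervalIntegrable (fun x : ℝ => (Real.log (1 - x) : ℂ) * momentIntegrand ν k ω α β n x)
        MeasureTheory.volume 0 1 ∧
      IntervalIntegrable
        (fun x : ℝ =>
          (Real.log x : ℂ) * (Real.log (1 - x) : ℂ) * momentIntegrand ν k ω α β n x)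
        MeasureTheory.volume 0 1) ∧
    -- the logarithmic moments are the partial derivatives of the moment
    (∀ n : ℤ,
      HasDerivAt (fun a : ℝ => moment ν k ω a β n) (logMoment1 ν k ω α β n) α ∧
      HasDerivAt (fun b : ℝ => moment ν k ω α b n) (logMoment2 ν k ω α β n) β ∧
      HasDerivAt (fun a : ℝ => deriv (fun b : ℝ => moment ν k ω a b n) β)
        (logMoment3 ν k ω α β n) α ∧
      HasDerivAt (fun b : ℝ => deriv (fun a : ℝ => moment ν k ω a b n) α)
        (logMoment3 ν k ω α β n) β) ∧
    -- the recurrences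
    (∀ n : ℤ, 4 ≤ n →
      nineTerm ν k ω α β (logMoment1 ν k ω α β) n
        = logRhs1 k α β (moment ν k ω α β) n ∧
      nineTerm ν k ω α β (logMoment2 ν k ω α β) n
        = logRhs2 k α β (moment ν k ω α β) n ∧
      nineTerm ν k ω α β (logMoment3 ν k ω α β) n
        = logRhs3 k α β (moment ν k ω α β) (logMoment1 ν k ω α β)
            (logMoment2 ν k ω α β) n) := by
  obtain ⟨hint, hderiv, hrec⟩ := mainTheorem2_general ν k ω α β hα hβ hω
  exact ⟨hint, hderiv, fun n _ => hrec n⟩
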